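/- A signing of size $n$ is an $n\times n$ matrix $s$ with entries in $\{+1,-1\}$; for a real $n\times n$ matrix $M$, the signed matrix $M(s)$ is the entrywise product of $M$ and $s$. \textsc{InvertibleSigning} is the following decision problem: given a real symmetric matrix $M$ (of any size $n$), decide whether there is a symmetric signing $s$ such that $M(s)$ is invertible. Theorem. There exists a polynomial-time algorithm to solve \textsc{InvertibleSigning}. Precisely: there is a Turing machine that, given a symmetric matrix with rational entries written in binary, decides \textsc{InvertibleSigning} in time polynomial in the length of the input. More generally, let a notation for real numbers be given, in which finite strings over a finite alphabet stand for real numbers, and suppose that it can be decided in time polynomial in the length of a string whether the number it stands for is zero. Then there is a Turing machine that, given a real symmetric matrix as the list of its rows with the entries written in this notation, decides \textsc{InvertibleSigning} in time polynomial in the length of the input. -/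

import Mathlib

open Matrix

/-- `s` is a signing: all its entries are `1` or `-1`. -/
def IsSigning {n : ℕ} (s : Matrix (Fin n) (Fin n) ℝ) : Prop :=
  ∀ i j, s i j = 1 ∨ s i j = -1

/-- The signed matrix `M(s)`: the entrywise product of `M` and `s`. -/
def signedMatrix {n : ℕ} (M s : Matrix (Fin n) (Fin n) ℝ) : Matrix (Fin n) (Fin n) ℝ :=
  M ⊙ s

/-- `M` has a symmetric signing `s` such that `M(s)` is invertible. -/
def HasInvertibleSigning {n : ℕ} (M : Matrix (Fin n) (Fin n) ℝ) : Prop :=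
  ∃ s : Matrix (Fin n) (Fin n) ℝ, IsSigning s ∧ s.IsSymm ∧ IsUnit (signedMatrix M s)

open Classical in
/-- The yes/no question `P`, on instances `a` presented as the strings `enc a`, is decided by a
Turing machine that runs in time polynomial in the length of the string (and ends with the
one-symbol string `true` or `false` as its output). -/
def PolyTimeDecidable {α Γ : Type} (enc : α → List Γ) (P : α → Prop) : Prop :=
  Nonempty (Turing.TM2ComputableInPolyTime enc Computability.encodeBool
    (fun a => decide (P a)))

/-- A square matrix of numerals (elements of `D`), where the numeral `d` stands for the real
number `val d`, such that the real matrix that it stands for is symmetric. -/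
structure SymMatrixInput {D : Type} (val : D → ℝ) where
  /-- the size of the matrix -/
  n : ℕ
  /-- the numerals in the matrix -/
  entries : Matrix (Fin n) (Fin n) D
  /-- the real matrix is symmetric -/
  symm : (entries.map val).IsSymm

/-- The real symmetric matrix that an input stands for. -/
def SymMatrixInput.toReal {D : Type} {val : D → ℝ} (A : SymMatrixInput val) :
    Matrix (Fin A.n) (Fin A.n) ℝ :=
  A.entries.map val

/-- The string presenting a matrix, row by row: every entry is written as `code d` followed by the
end-of-entry mark `Sum.inr false`, and every row is followed by the end-of-row mark
`Sum.inr true`. -/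
def SymMatrixInput.encode {D Γ : Type} {val : D → ℝ} (code : D → List Γ)
    (A : SymMatrixInput val) : List (Γ ⊕ Bool) :=
  (List.ofFn fun i => (List.ofFn fun j =>
    (code (A.entries i j)).map Sum.inl ++ [Sum.inr false]).flatten ++ [Sum.inr true]).flatten

/-- InvertibleSigning for matrices whose entries are written in the number system
`(code, val)` is solvable in polynomial time. -/
def InvertibleSigningInPolyTime {D Γ : Type} (code : D → List Γ) (val : D → ℝ) : Prop :=
  PolyTimeDecidable (SymMatrixInput.encode (val := val) code)
    (fun A => HasInvertibleSigning A.toReal)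

/-- The standard binary notation of a rational number in lowest terms: a sign bit, the binary
digits of the absolute value of the numerator, a separator, the binary digits of the
denominator. -/
def ratBinary (q : ℚ) : List Computability.Γ' :=
  Computability.Γ'.bit (decide (q < 0)) ::
    ((Computability.encodeNat q.num.natAbs).map Computability.Γ'.bit ++
      Computability.Γ'.comma :: (Computability.encodeNat q.den).map Computability.Γ'.bit)

/-! Combinatorial core. A symmetric `M` has an invertible symmetric signing exactly when its support
contains a permutation (`hasInvertibleSigning_iff`). Without such a permutation every Leibniz term
of every signed matrix vanishes. Conversely, the signs of `M` can be absorbed into the signing, so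
`M` is replaced by a nonnegative matrix `N`; fix `π₀` in its support. The product `edgeSign π s` of
the signs that `π` uses is, in `s`, a character of the group of sign assignments to unordered pairs.
Multiply the determinant of `N` signed by `s` by `sign π₀ * edgeSign π₀ s` and sum over all `s`. By
orthogonality (`sum_edgeSign`) only those `π` survive whose character equals that of `π₀`. They
share with `π₀` the fixed points and the parity of the use of every edge, hence the sign: long
cycles agree up to direction, and 2-cycles cover the same points
(`Equiv.Perm.sign_eq_of_edge_parity`). So all surviving terms are nonnegative and that of `π₀` is
positive; some determinant is nonzero.

Algorithm. Only the zero pattern matters, and the question is whether a bipartite graph has a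
perfect matching. It is answered by an auction: an unassigned row takes a column of its support
whose price does not exceed its offer, which raises that price by one and makes the previous owner
the next bidder; if there is no such column, the offer rises by one. Twice the sum of the prices
plus the offer grows with every step until all rows are assigned. If a perfect matching exists,
Hall's condition keeps the offer at most `n` (`State.Inv.label_le`), so `6 * n ^ 2` steps complete
the matching; if rows are left over, there is none.

Machine. The given zero test is run as a subroutine on each entry, and the auction works with unary
prices. Polynomial time (`Bounded`) is proved for arbitrary memory contents and separately from the
computed result (`Leads`); determinism joins the two in `Bounded.runs`. -/

/-! ### Iterated transitions -/

/-- `Steps f t a b`: the transition function `f` leads from `a` to `b` in exactly `t` steps. -/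
inductive Steps {α : Type*} (f : α → Option α) : ℕ → α → α → Prop
  | refl (a : α) : Steps f 0 a a
  | head {t : ℕ} {a b c : α} (h : f a = some b) (hs : Steps f t b c) : Steps f (t + 1) a c

namespace Steps

variable {α β : Type*} {f : α → Option α} {g : β → Option β}

theorem single {a b : α} (h : f a = some b) : Steps f 1 a b := .head h (.refl b)

theorem trans {s t : ℕ} {a b c : α} (h : Steps f s a b) (h' : Steps f t b c) :
    Steps f (s + t) a c := by
  induction h with
  | refl => simpa using h'
  | head e _ ih => rw [Nat.add_right_comm]; exact .head e (ih h')

theorem map (φ : α → β) (hφ : ∀ a b, f a = some b → g (φ a) = some (φ b)) {t : ℕ} {a b : α}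
    (h : Steps f t a b) : Steps g t (φ a) (φ b) := by
  induction h with
  | refl => exact .refl _
  | head e _ ih => exact .head (hφ _ _ e) ih

/-- Determinism: both runs follow the same path, and neither can continue past a halting point. -/
theorem eq_of_halt {s t : ℕ} {a b c : α} (h : Steps f s a b) (h' : Steps f t a c)
    (hb : f b = none) (hc : f c = none) : b = c := by
  induction h generalizing t with
  | refl =>
    cases h' with
    | refl => rfl
    | head e _ => simp [hb] at e
  | head e _ ih =>
    cases h' with
    | refl => simp [hc] at e
    | head e' h' =>
      rw [e, Option.some_inj] at e'
      subst e'
      exact ih h' hb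

theorem iterate_eq {t : ℕ} {a b : α} (h : Steps f t a b) :
    (flip bind f)^[t] (some a) = some b := by
  induction h with
  | refl => rfl
  | head e _ ih => rw [Function.iterate_succ_apply, ← ih, ← e]; rfl

/-- The value `none` is absorbing, so an iteration that ends in `some b` never halted on the way. -/
theorem of_iterate_eq {t : ℕ} {a b : α} (h : (flip bind f)^[t] (some a) = some b) :
    Steps f t a b := by
  induction t generalizing a with
  | zero => cases h; exact .refl _
  | succ t ih =>
    rw [Function.iterate_succ_apply] at h
    cases e : f a with
    | none =>
      have hn : flip bind f (some a) = none := e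
      have : ∀ t, (flip bind f)^[t] none = none := fun t => by
        induction t with
        | zero => rfl
        | succ t ih => rw [Function.iterate_succ_apply]; exact ih
      rw [hn, this] at h
      cases h
    | some a' =>
      have hn : flip bind f (some a) = some a' := e
      rw [hn] at h
      exact .head e (ih h)

end Steps

/-! ### Routines: stack machines as building blocks -/

open Turing TM2 in
/-- Relabel the jumps of a statement by `φ` and replace halting by a jump to `x`, if there is one. -/
def Turing.TM2.Stmt.relabel {K Λ Λ' σ : Type} {Γ : K → Type} (φ : Λ → Λ') (x : Option Λ') :
    Stmt Γ Λ σ → Stmt Γ Λ' σ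
  | .push k f q => .push k f (q.relabel φ x)
  | .peek k f q => .peek k f (q.relabel φ x)
  | .pop k f q => .pop k f (q.relabel φ x)
  | .load f q => .load f (q.relabel φ x)
  | .branch f q q' => .branch f (q.relabel φ x) (q'.relabel φ x)
  | .goto f => .goto fun v => φ (f v)
  | .halt => x.elim .halt fun l => .goto fun _ => l

/-- A stack machine routine, which shares its stacks and its internal memory with others. -/
structure Routine {K : Type} (Γ : K → Type) (σ : Type) where
  /-- the labels of the routine -/
  Λ : Type
  [fin : Fintype Λ]
  /-- the label of its first statement -/
  main : Λ
  /-- its statements -/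
  code : Λ → Turing.TM2.Stmt Γ Λ σ

attribute [instance] Routine.fin

open Turing

/-- The internal memory and the stacks of a machine. -/
abbrev Memory {K : Type} (Γ : K → Type) (σ : Type) : Type := σ × ∀ k, List (Γ k)

namespace Routine

section

variable {K Λ Λ' σ : Type} {Γ : K → Type}

/-- The effect on configurations of relabelling the statements. -/
def relabelCfg (φ : Λ → Λ') (x : Option Λ') (c : TM2.Cfg Γ Λ σ) : TM2.Cfg Γ Λ' σ :=
  ⟨c.l.elim x (fun l => some (φ l)), c.var, c.stk⟩

variable [DecidableEq K]

theorem stepAux_relabel (φ : Λ → Λ') (x : Option Λ') (q : TM2.Stmt Γ Λ σ) (v : σ)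
    (S : ∀ k, List (Γ k)) :
    TM2.stepAux (q.relabel φ x) v S = relabelCfg φ x (TM2.stepAux q v S) := by
  induction q generalizing v S with
  | branch f q q' ih ih' =>
    simp only [TM2.Stmt.relabel, TM2.stepAux]
    cases f v
    · exact ih' v S
    · exact ih v S
  | goto f => rfl
  | halt => cases x <;> rfl
  | push k f q ih => exact ih _ _
  | peek k f q ih => exact ih _ _
  | pop k f q ih => exact ih _ _
  | load f q ih => exact ih _ _

theorem steps_relabel {M : Λ → TM2.Stmt Γ Λ σ} {N : Λ' → TM2.Stmt Γ Λ' σ} {φ : Λ → Λ'}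
    {x : Option Λ'} (h : ∀ l, N (φ l) = (M l).relabel φ x) {t : ℕ} {a b : TM2.Cfg Γ Λ σ}
    (hs : Steps (TM2.step M) t a b) :
    Steps (TM2.step N) t (relabelCfg φ x a) (relabelCfg φ x b) := by
  refine hs.map _ ?_
  rintro ⟨l, v, S⟩ b hb
  cases l with
  | none => simp at hb
  | some l =>
    simp only [TM2.step, Option.some_inj] at hb
    subst hb
    simp only [relabelCfg, Option.elim, TM2.step, h, stepAux_relabel]

/-- Started on the memory `c`, the routine `A` halts within `t` steps with the memory `c'`. -/
def Runs (A : Routine Γ σ) (c c' : Memory Γ σ) (t : ℕ) : Prop :=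
  ∃ s ≤ t, Steps (TM2.step A.code) s ⟨some A.main, c.1, c.2⟩ ⟨none, c'.1, c'.2⟩

theorem Runs.mono {A : Routine Γ σ} {c c' : Memory Γ σ} {t t' : ℕ} (h : A.Runs c c' t)
    (ht : t ≤ t') : A.Runs c c' t' := by
  obtain ⟨s, hs, h⟩ := h
  exact ⟨s, hs.trans ht, h⟩

theorem Runs.unique {A : Routine Γ σ} {c d e : Memory Γ σ} {t t' : ℕ} (h : A.Runs c d t)
    (h' : A.Runs c e t') : d = e := by
  obtain ⟨s, -, h⟩ := h
  obtain ⟨s', -, h'⟩ := h'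
  have := h.eq_of_halt h' rfl rfl
  simp only [TM2.Cfg.mk.injEq, true_and] at this
  exact Prod.ext this.1 this.2

/-- Run `A`, then `B`. -/
def seq (A B : Routine Γ σ) : Routine Γ σ where
  Λ := A.Λ ⊕ B.Λ
  main := .inl A.main
  code := Sum.elim (fun l => (A.code l).relabel .inl (some (.inr B.main)))
    fun l => (B.code l).relabel .inr none

theorem Runs.seq {A B : Routine Γ σ} {c d e : Memory Γ σ} {s t : ℕ} (hA : A.Runs c d s)
    (hB : B.Runs d e t) : (A.seq B).Runs c e (s + t) := by
  obtain ⟨s', hs, hA⟩ := hA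
  obtain ⟨t', ht, hB⟩ := hB
  refine ⟨s' + t', add_le_add hs ht, ?_⟩
  have h₁ := steps_relabel (N := (A.seq B).code) (φ := .inl) (x := some (.inr B.main))
    (fun _ => rfl) hA
  have h₂ := steps_relabel (N := (A.seq B).code) (φ := .inr) (x := none) (fun _ => rfl) hB
  exact h₁.trans h₂

variable {ι : Type} [Fintype ι]

/-- Execute the statement `q`; if it jumps to `i`, run the routine `B i`. -/
def switch (q : TM2.Stmt Γ ι σ) (B : ι → Routine Γ σ) : Routine Γ σ where
  Λ := Option (Σ i, (B i).Λ)
  main := none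
  code l := l.elim (q.relabel (fun i => some ⟨i, (B i).main⟩) none)
    fun l => ((B l.1).code l.2).relabel (fun m => some ⟨l.1, m⟩) none

/-- Execute the statement `q`; if it jumps to `i`, run the routine `B i` and start again. -/
def loop (q : TM2.Stmt Γ ι σ) (B : ι → Routine Γ σ) : Routine Γ σ where
  Λ := Option (Σ i, (B i).Λ)
  main := none
  code l := l.elim (q.relabel (fun i => some ⟨i, (B i).main⟩) none)
    fun l => ((B l.1).code l.2).relabel (fun m => some ⟨l.1, m⟩) (some none)

variable {q : TM2.Stmt Γ ι σ} {B : ι → Routine Γ σ} {c d e : Memory Γ σ} {t t' : ℕ}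

theorem Runs.switch_halt (h : TM2.stepAux q c.1 c.2 = ⟨none, d.1, d.2⟩) :
    (switch q B).Runs c d 1 := by
  refine ⟨1, le_rfl, .single ?_⟩
  simp [switch, stepAux_relabel, h, relabelCfg]

theorem Runs.switch_goto {i : ι} (h : TM2.stepAux q c.1 c.2 = ⟨some i, d.1, d.2⟩)
    (hB : (B i).Runs d e t) : (switch q B).Runs c e (t + 1) := by
  obtain ⟨t', ht, hB⟩ := hB
  refine ⟨t' + 1, by lia, .head (b := ⟨some (some ⟨i, (B i).main⟩), d.1, d.2⟩) ?_ ?_⟩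
  · simp [switch, stepAux_relabel, h, relabelCfg]
  · exact steps_relabel (N := (switch q B).code) (φ := fun l => some ⟨i, l⟩) (x := none)
      (fun _ => rfl) hB

theorem Runs.loop_halt (h : TM2.stepAux q c.1 c.2 = ⟨none, d.1, d.2⟩) :
    (loop q B).Runs c d 1 := by
  refine ⟨1, le_rfl, .single ?_⟩
  simp [loop, stepAux_relabel, h, relabelCfg]

theorem Runs.loop_goto {i : ι} {c' : Memory Γ σ}
    (h : TM2.stepAux q c.1 c.2 = ⟨some i, d.1, d.2⟩) (hB : (B i).Runs d e t)
    (hL : (loop q B).Runs e c' t') : (loop q B).Runs c c' (t + t' + 1) := by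
  obtain ⟨s, hs, hB⟩ := hB
  obtain ⟨s', hs', hL⟩ := hL
  refine ⟨s + s' + 1, by lia, .head (b := ⟨some (some ⟨i, (B i).main⟩), d.1, d.2⟩) ?_ ?_⟩
  · simp [loop, stepAux_relabel, h, relabelCfg]
  · exact (steps_relabel (N := (loop q B).code) (φ := fun l => some ⟨i, l⟩) (x := some none)
      (fun _ => rfl) hB).trans hL

/-- Execute a single statement. -/
def op (q : TM2.Stmt Γ Empty σ) : Routine Γ σ := switch q fun i => i.elim

/-- Do nothing. -/
def skip : Routine Γ σ := op .halt

theorem Runs.op {q : TM2.Stmt Γ Empty σ} (h : TM2.stepAux q c.1 c.2 = ⟨none, d.1, d.2⟩) :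
    (op q).Runs c d 1 := Runs.switch_halt h

theorem Runs.skip : (skip : Routine Γ σ).Runs c c 1 := Runs.op rfl

end

/-! ### Routines on some of the stacks of a larger machine -/

section lift

variable {K K₁ Λ σ σ₁ : Type} {Γ : K → Type} (e : K₁ → K) (get : σ → σ₁) (put : σ₁ → σ → σ)

/-- Let a statement act on the stacks `e k` and on a part of the internal memory. -/
def liftStmt : TM2.Stmt (fun k => Γ (e k)) Λ σ₁ → TM2.Stmt Γ Λ σ
  | .push k f q => .push (e k) (fun v => f (get v)) (liftStmt q)
  | .peek k f q => .peek (e k) (fun v o => put (f (get v) o) v) (liftStmt q)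
  | .pop k f q => .pop (e k) (fun v o => put (f (get v) o) v) (liftStmt q)
  | .load f q => .load (fun v => put (f (get v)) v) (liftStmt q)
  | .branch f q q' => .branch (fun v => f (get v)) (liftStmt q) (liftStmt q')
  | .goto f => .goto fun v => f (get v)
  | .halt => .halt

/-- Let a routine act on the stacks `e k` and on a part of the internal memory. -/
def lift (A : Routine (fun k => Γ (e k)) σ₁) : Routine Γ σ where
  Λ := A.Λ
  main := A.main
  code l := liftStmt e get put (A.code l)

variable [DecidableEq K] [DecidableEq K₁] {e get put}

/-- Injectivity of `e` makes updating a stack commute with restricting to the chosen stacks; the two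
laws for `get` and `put` do the same for the internal memory. -/
theorem stepAux_liftStmt (he : e.Injective) (hg : ∀ a s, get (put a s) = a)
    (hp : ∀ a b s, put a (put b s) = put a s) (s₀ : σ)
    (q : TM2.Stmt (fun k => Γ (e k)) Λ σ₁) (v : σ₁) (S : ∀ k, List (Γ k)) :
    ∃ S', TM2.stepAux (liftStmt e get put q) (put v s₀) S =
        ⟨(TM2.stepAux q v fun k => S (e k)).l, put (TM2.stepAux q v fun k => S (e k)).var s₀, S'⟩ ∧
      (∀ k, S' (e k) = (TM2.stepAux q v fun k => S (e k)).stk k) ∧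
      ∀ k, (∀ k₁, e k₁ ≠ k) → S' k = S k := by
  have hupd : ∀ k (x : List (Γ (e k))), (fun k₁ => Function.update S (e k) x (e k₁)) =
      Function.update (fun k₁ => S (e k₁)) k x := by
    intro k x
    funext k₁
    rcases eq_or_ne k₁ k with rfl | h
    · simp
    · simp [h, he.ne h]
  induction q generalizing v S with
  | push k f q ih =>
    obtain ⟨S', h₁, h₂, h₃⟩ := ih v (Function.update S (e k) (f v :: S (e k))) (by
      intro k' x; funext k₁
      rcases eq_or_ne k₁ k' with rfl | h
      · simp
      · simp [h, he.ne h])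
    rw [hupd] at h₁ h₂
    refine ⟨S', by simpa [liftStmt, hg] using h₁, h₂, fun k' hk' => ?_⟩
    rw [h₃ k' hk', Function.update_of_ne (hk' k).symm]
  | pop k f q ih =>
    obtain ⟨S', h₁, h₂, h₃⟩ := ih (f v (S (e k)).head?)
      (Function.update S (e k) (S (e k)).tail) (by
      intro k' x; funext k₁
      rcases eq_or_ne k₁ k' with rfl | h
      · simp
      · simp [h, he.ne h])
    rw [hupd] at h₁ h₂
    refine ⟨S', by simpa [liftStmt, hg, hp] using h₁, h₂, fun k' hk' => ?_⟩
    rw [h₃ k' hk', Function.update_of_ne (hk' k).symm]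
  | peek k f q ih =>
    obtain ⟨S', h₁, h₂, h₃⟩ := ih (f v (S (e k)).head?) S hupd
    exact ⟨S', by simpa [liftStmt, hg, hp] using h₁, h₂, h₃⟩
  | load f q ih =>
    obtain ⟨S', h₁, h₂, h₃⟩ := ih (f v) S hupd
    exact ⟨S', by simpa [liftStmt, hg, hp] using h₁, h₂, h₃⟩
  | branch f q q' ih ih' =>
    simp only [liftStmt, TM2.stepAux, hg]
    cases f v
    · exact ih' v S hupd
    · exact ih v S hupd
  | goto f => exact ⟨S, by simp [liftStmt, hg], fun _ => rfl, fun _ _ => rfl⟩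
  | halt => exact ⟨S, by simp [liftStmt], fun _ => rfl, fun _ _ => rfl⟩

theorem Runs.lift (he : e.Injective) (hg : ∀ a s, get (put a s) = a)
    (hp : ∀ a b s, put a (put b s) = put a s) (s₀ : σ) {A : Routine (fun k => Γ (e k)) σ₁}
    {S : ∀ k, List (Γ k)} {v : σ₁} {c' : Memory (fun k => Γ (e k)) σ₁} {t : ℕ}
    (h : A.Runs (v, fun k => S (e k)) c' t) :
    ∃ S', (lift e get put A).Runs (put v s₀, S) (put c'.1 s₀, S') t ∧
      (∀ k, S' (e k) = c'.2 k) ∧ ∀ k, (∀ k₁, e k₁ ≠ k) → S' k = S k := by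
  obtain ⟨s, hs, h⟩ := h
  suffices H : ∀ a b, Steps (TM2.step A.code) s a b → ∀ S, a.stk = (fun k => S (e k)) →
      ∃ S', Steps (TM2.step (Routine.lift e get put A).code) s ⟨a.l, put a.var s₀, S⟩
        ⟨b.l, put b.var s₀, S'⟩ ∧ (∀ k, S' (e k) = b.stk k) ∧
        ∀ k, (∀ k₁, e k₁ ≠ k) → S' k = S k by
    obtain ⟨S', h₁, h₂, h₃⟩ := H _ _ h S rfl
    exact ⟨S', ⟨s, hs, h₁⟩, h₂, h₃⟩
  clear hs h
  intro a b hab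
  induction hab with
  | refl a => exact fun S hS => ⟨S, .refl _, fun k => by rw [hS], fun _ _ => rfl⟩
  | @head t a b c hab _ ih =>
    intro S hS
    obtain ⟨l, v, S₁⟩ := a
    cases l with
    | none => simp at hab
    | some l =>
      simp only [TM2.step, Option.some_inj] at hab hS
      subst hS
      obtain ⟨S₂, h₁, h₂, h₃⟩ := stepAux_liftStmt he hg hp s₀ (A.code l) v S
      rw [hab] at h₁ h₂
      obtain ⟨S', h₄, h₅, h₆⟩ := ih S₂ (funext fun k => (h₂ k).symm)
      exact ⟨S', .head (congrArg some h₁) h₄, h₅, fun k hk => (h₆ k hk).trans (h₃ k hk)⟩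

end lift

/-! ### Routines that run in polynomial time -/

section Bounded

variable {K σ : Type} [DecidableEq K] [Fintype K] {Γ : K → Type}

/-- The total length of the stacks. -/
def stackSize (S : ∀ k, List (Γ k)) : ℕ := ∑ k, (S k).length

theorem eval_mono (p : Polynomial ℕ) {m n : ℕ} (h : m ≤ n) : p.eval m ≤ p.eval n := by
  rw [Polynomial.eval_eq_sum, Polynomial.eval_eq_sum]
  exact Finset.sum_le_sum fun i _ => Nat.mul_le_mul_left _ (Nat.pow_le_pow_left h i)

/-- `A` halts in time polynomial in the total length of the stacks, does not increase this length,
and changes at most the stacks in `T`. -/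
def Bounded (A : Routine Γ σ) (T : Finset K) : Prop :=
  ∃ p : Polynomial ℕ, ∀ c, ∃ c', A.Runs c c' (p.eval (stackSize c.2)) ∧
    stackSize c'.2 ≤ stackSize c.2 ∧ ∀ k ∉ T, c'.2 k = c.2 k

/-- Since `A` does not enlarge the stacks, the bound for `B` may be evaluated at the initial size:
the polynomials add up and need not be composed. -/
theorem Bounded.seq {A B : Routine Γ σ} {T T' : Finset K} (hA : A.Bounded T)
    (hB : B.Bounded T') : (A.seq B).Bounded (T ∪ T') := by
  obtain ⟨p, hp⟩ := hA
  obtain ⟨p', hp'⟩ := hB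
  refine ⟨p + p', fun c => ?_⟩
  obtain ⟨d, h₁, h₂, h₃⟩ := hp c
  obtain ⟨e, h₁', h₂', h₃'⟩ := hp' d
  refine ⟨e, ?_, h₂'.trans h₂, fun k hk => ?_⟩
  · rw [Polynomial.eval_add]
    exact (h₁.seq h₁').mono (add_le_add_right (eval_mono p' h₂) _)
  · simp only [Finset.mem_union, not_or] at hk
    exact (h₃' k hk.2).trans (h₃ k hk.1)

variable {ι : Type} [Fintype ι] {q : TM2.Stmt Γ ι σ} {B : ι → Routine Γ σ}

theorem Bounded.switch {T : Finset K}
    (hq : ∀ v S, stackSize (TM2.stepAux q v S).stk ≤ stackSize S ∧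
      ∀ k ∉ T, (TM2.stepAux q v S).stk k = S k)
    (hB : ∀ i, (B i).Bounded T) : (switch q B).Bounded T := by
  choose p hp using hB
  refine ⟨∑ i, p i + 1, fun c => ?_⟩
  obtain ⟨h₁, h₂⟩ := hq c.1 c.2
  rcases hl : TM2.stepAux q c.1 c.2 with ⟨l, v, S⟩
  rw [hl] at h₁ h₂
  cases l with
  | none =>
    exact ⟨(v, S), (Runs.switch_halt hl).mono (by simp), h₁, h₂⟩
  | some i =>
    obtain ⟨d, h₁', h₂', h₃'⟩ := hp i (v, S)
    refine ⟨d, (Runs.switch_goto (d := (v, S)) hl h₁').mono ?_, h₂'.trans h₁,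
      fun k hk => (h₃' k hk).trans (h₂ k hk)⟩
    simp only [Polynomial.eval_add, Polynomial.eval_one, Polynomial.eval_finsetSum]
    have := Finset.single_le_sum (f := fun i => (p i).eval (stackSize c.2))
      (fun _ _ => Nat.zero_le _) (Finset.mem_univ i)
    have := eval_mono (p i) h₁
    dsimp only at *
    lia

theorem Bounded.op {q : TM2.Stmt Γ Empty σ} {T : Finset K}
    (hq : ∀ v S, stackSize (TM2.stepAux q v S).stk ≤ stackSize S ∧
      ∀ k ∉ T, (TM2.stepAux q v S).stk k = S k) : (op q).Bounded T :=
  Bounded.switch hq fun i => i.elim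

theorem Bounded.skip : (skip : Routine Γ σ).Bounded ∅ :=
  Bounded.op fun _ _ => ⟨le_rfl, fun _ _ => rfl⟩

theorem Bounded.mono {A : Routine Γ σ} {T T' : Finset K} (hA : A.Bounded T) (h : T ⊆ T') :
    A.Bounded T' := by
  obtain ⟨p, hp⟩ := hA
  refine ⟨p, fun c => ?_⟩
  obtain ⟨d, h₁, h₂, h₃⟩ := hp c
  exact ⟨d, h₁, h₂, fun k hk => h₃ k fun hk' => hk (h hk')⟩

/-- A loop runs in polynomial time if each iteration shortens the stack `X`. -/
theorem Bounded.loop (X : K) {T T' : Finset K}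
    (hq : ∀ v S, stackSize (TM2.stepAux q v S).stk ≤ stackSize S ∧
      (∀ k ∉ T, (TM2.stepAux q v S).stk k = S k) ∧
      ((TM2.stepAux q v S).l ≠ none → ((TM2.stepAux q v S).stk X).length < (S X).length))
    (hB : ∀ i, (B i).Bounded T') (hX : X ∉ T') (hT : T' ⊆ T) : (loop q B).Bounded T := by
  choose p hp using hB
  -- The length `m` of `X` counts the remaining iterations. The size bound `n` stays fixed, because
  -- no iteration enlarges the stacks, so each one costs at most the same amount.
  suffices H : ∀ m n : ℕ, ∀ c : Memory Γ σ, (c.2 X).length ≤ m → stackSize c.2 ≤ n →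
      ∃ c', (Routine.loop q B).Runs c c' (m * ((∑ i, p i).eval n + 1) + 1) ∧
        stackSize c'.2 ≤ stackSize c.2 ∧ ∀ k ∉ T, c'.2 k = c.2 k by
    refine ⟨Polynomial.X * (∑ i, p i + 1) + 1, fun c => ?_⟩
    obtain ⟨c', h⟩ := H (stackSize c.2) (stackSize c.2) c
      (Finset.single_le_sum (f := fun k => (c.2 k).length) (fun _ _ => Nat.zero_le _)
        (Finset.mem_univ X)) le_rfl
    exact ⟨c', by simpa using h⟩
  intro m n
  induction m with
  | zero =>
    intro c hc hn
    obtain ⟨h₁, h₂, h₃⟩ := hq c.1 c.2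
    rcases hl : TM2.stepAux q c.1 c.2 with ⟨l, v, S⟩
    rw [hl] at h₁ h₂ h₃
    cases l with
    | none => exact ⟨(v, S), (Runs.loop_halt hl).mono (by simp), h₁, h₂⟩
    | some i => have := h₃ (by simp); lia
  | succ m ih =>
    intro c hc hn
    obtain ⟨h₁, h₂, h₃⟩ := hq c.1 c.2
    rcases hl : TM2.stepAux q c.1 c.2 with ⟨l, v, S⟩
    rw [hl] at h₁ h₂ h₃
    cases l with
    | none => exact ⟨(v, S), (Runs.loop_halt hl).mono (by simp), h₁, h₂⟩
    | some i =>
      obtain ⟨d, g₁, g₂, g₃⟩ := hp i (v, S)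
      have hlt := h₃ (by simp)
      have hdX : (d.2 X).length ≤ m := by rw [g₃ X hX]; dsimp only at *; lia
      obtain ⟨c', k₁, k₂, k₃⟩ := ih d hdX (g₂.trans (h₁.trans hn))
      refine ⟨c', (Runs.loop_goto (d := (v, S)) hl g₁ k₁).mono ?_, k₂.trans (g₂.trans h₁),
        fun k hk => (k₃ k hk).trans ((g₃ k fun hk' => hk (hT hk')).trans (h₂ k hk))⟩
      have e₁ := eval_mono (p i) (h₁.trans hn)
      have e₂ := Finset.single_le_sum (f := fun i => (p i).eval n)
        (fun _ _ => Nat.zero_le _) (Finset.mem_univ i)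
      rw [Polynomial.eval_finsetSum]
      dsimp only at *
      have := add_mul m 1 (∑ i, (p i).eval n + 1)
      lia

end Bounded

end Routine

/-! ### The auction machine -/

namespace Auction

open Routine

/-- The stack symbols of the auction machine. -/
inductive Sym
  | tick | mid | bit (b : Bool)
  deriving DecidableEq

instance : Fintype Sym where
  elems := {.tick, .mid, .bit true, .bit false}
  complete a := by rcases a with _ | _ | _ | _ <;> decide

/-- The stacks of the auction machine. -/
inductive Reg
  | pending | row | rowDone | label | labelDone | cols | colsDone | fuel
  deriving DecidableEq

instance : Fintype Reg where
  elems := {.pending, .row, .rowDone, .label, .labelDone, .cols, .colsDone, .fuel}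
  complete k := by cases k <;> decide

/-- The modes of a scan of the columns: searching for a column, taking over the row of the column
that was found, or copying the remaining columns. -/
inductive Mode
  | scan | swap | done
  deriving DecidableEq

instance : Fintype Mode where
  elems := {.scan, .swap, .done}
  complete m := by cases m <;> decide

/-- The internal memory of the auction machine: the symbol read last and the mode. -/
abbrev Ctl : Type := Option Sym × Mode

/-- The contents of the stacks. -/
abbrev Store : Type := ∀ _ : Reg, List Sym

/-- Statements of the auction machine. -/
abbrev AStmt (ι : Type) : Type := TM2.Stmt (fun _ : Reg => Sym) ι Ctl

/-- Routines of the auction machine. -/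
abbrev ARoutine : Type 1 := Routine (fun _ : Reg => Sym) Ctl

/-- Store the symbol that was read. -/
def setTop (v : Ctl) (o : Option Sym) : Ctl := (o, v.2)

/-- The symbol read last. -/
def topSym (v : Ctl) : Sym := v.1.getD .tick

/-- Whether a symbol was read and is a bit. -/
def isBit : Option Sym → Bool
  | some (.bit _) => true
  | _ => false

/-- Move a stack onto another one, in reverse. -/
def move (X Y : Reg) : ARoutine :=
  loop (ι := Unit) (.pop X setTop (.branch (fun v => v.1.isSome)
    (.push Y topSym (.goto fun _ => ())) .halt)) fun _ => skip

/-- Empty a stack. -/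
def drain (X : Reg) : ARoutine :=
  loop (ι := Unit) (.pop X setTop (.branch (fun v => v.1.isSome) (.goto fun _ => ()) .halt))
    fun _ => skip

/-- Empty all stacks. -/
def drainAll : ARoutine :=
  ((drain .pending).seq ((drain .row).seq ((drain .rowDone).seq ((drain .label).seq
    ((drain .labelDone).seq ((drain .cols).seq ((drain .colsDone).seq (drain .fuel))))))))

/-- If there is no current row, load the next pending row. -/
def loadRow : ARoutine :=
  switch (ι := Unit) (.peek .row setTop (.branch (fun v => v.1.isSome)
      (.load (fun v => (none, v.2)) .halt) (.pop .pending setTop (.goto fun _ => ()))))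
    fun _ => loop (ι := Unit) (.peek .pending setTop (.branch (fun v => isBit v.1)
      (.pop .pending setTop (.push .row topSym (.goto fun _ => ())))
      (.load (fun v => (none, v.2)) .halt))) fun _ => skip

/-- Process the next symbol of the columns. -/
def scanStmt : AStmt (Option Bool) :=
  .pop .cols setTop <| .branch (fun v => v.1.isNone) .halt <|
  .branch (fun v => v.2 = .swap ∧ isBit v.1) (.push .rowDone topSym <| .goto fun _ => none) <|
  .branch (fun v => v.2 ≠ .scan)
    (.load (fun v => (v.1, .done)) <| .push .colsDone topSym <| .goto fun _ => none) <|
  .branch (fun v => isBit v.1) (.push .colsDone topSym <| .goto fun _ => none) <|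
  .branch (fun v => v.1 = some .tick)
    (.push .colsDone topSym <| .pop .label setTop <| .branch (fun v => v.1.isNone)
      (.goto fun _ => none) (.push .labelDone topSym <| .goto fun _ => none)) <|
  .pop .row setTop <| .branch (fun v => v.1.isNone)
    (.push .colsDone (fun _ => .mid) <| .goto fun _ => some false) <|
  .push .rowDone topSym <| .branch (fun v => v.1 ≠ some (.bit true))
    (.push .colsDone (fun _ => .mid) <| .goto fun _ => some false) <|
  .pop .label setTop <| .branch (fun v => v.1.isNone)
    (.push .colsDone (fun _ => .mid) <| .goto fun _ => some false) <|
  .push .colsDone (fun _ => .tick) <| .push .colsDone (fun _ => .mid) <|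
  .load (fun v => (v.1, .swap)) <| .goto fun _ => some true

/-- What remains to be done after reading a symbol: nothing, restoring the label, or assigning the
current row to the current column. -/
def scanBody : Option Bool → ARoutine
  | none => skip
  | some false => move .labelDone .label
  | some true => (move .labelDone .label).seq <| (op (.pop .label setTop .halt)).seq <|
      (move .rowDone .row).seq (move .row .colsDone)

/-- Scan the columns. -/
def scan : ARoutine := loop scanStmt scanBody

/-- One step of the auction: the current row takes the first affordable column, if there is one. -/
def bid : ARoutine :=
  loadRow.seq <| scan.seq <| (move .colsDone .cols).seq <| (move .rowDone .row).seq <|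
    op (.load (fun _ => (none, .scan)) .halt)

/-- The auction: as many steps as there is fuel. -/
def auction : ARoutine :=
  loop (ι := Unit) (.pop .fuel setTop (.branch (fun v => v.1.isSome)
    (.push .label (fun _ => .tick) (.goto fun _ => ())) .halt)) fun _ => bid

/-! #### The running time -/

/-- The store with the given contents. -/
def regs (p r r' e e' c c' f : List Sym) : Store
  | .pending => p
  | .row => r
  | .rowDone => r'
  | .label => e
  | .labelDone => e'
  | .cols => c
  | .colsDone => c'
  | .fuel => f

theorem eq_regs (S : Store) : S = regs (S .pending) (S .row) (S .rowDone) (S .label)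
    (S .labelDone) (S .cols) (S .colsDone) (S .fuel) := by
  funext k; cases k <;> rfl

section

variable (p r r' e e' c c' f x : List Sym)

@[simp] theorem update_pending : Function.update (regs p r r' e e' c c' f) .pending x =
    regs x r r' e e' c c' f := by funext k; cases k <;> simp [Function.update, regs]
@[simp] theorem update_row : Function.update (regs p r r' e e' c c' f) .row x =
    regs p x r' e e' c c' f := by funext k; cases k <;> simp [Function.update, regs]
@[simp] theorem update_rowDone : Function.update (regs p r r' e e' c c' f) .rowDone x =
    regs p r x e e' c c' f := by funext k; cases k <;> simp [Function.update, regs]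
@[simp] theorem update_label : Function.update (regs p r r' e e' c c' f) .label x =
    regs p r r' x e' c c' f := by funext k; cases k <;> simp [Function.update, regs]
@[simp] theorem update_labelDone : Function.update (regs p r r' e e' c c' f) .labelDone x =
    regs p r r' e x c c' f := by funext k; cases k <;> simp [Function.update, regs]
@[simp] theorem update_cols : Function.update (regs p r r' e e' c c' f) .cols x =
    regs p r r' e e' x c' f := by funext k; cases k <;> simp [Function.update, regs]
@[simp] theorem update_colsDone : Function.update (regs p r r' e e' c c' f) .colsDone x =
    regs p r r' e e' c x f := by funext k; cases k <;> simp [Function.update, regs]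
@[simp] theorem update_fuel : Function.update (regs p r r' e e' c c' f) .fuel x =
    regs p r r' e e' c c' x := by funext k; cases k <;> simp [Function.update, regs]

@[simp] theorem regs_pending : regs p r r' e e' c c' f .pending = p := rfl
@[simp] theorem regs_row : regs p r r' e e' c c' f .row = r := rfl
@[simp] theorem regs_rowDone : regs p r r' e e' c c' f .rowDone = r' := rfl
@[simp] theorem regs_label : regs p r r' e e' c c' f .label = e := rfl
@[simp] theorem regs_labelDone : regs p r r' e e' c c' f .labelDone = e' := rfl
@[simp] theorem regs_cols : regs p r r' e e' c c' f .cols = c := rfl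
@[simp] theorem regs_colsDone : regs p r r' e e' c c' f .colsDone = c' := rfl
@[simp] theorem regs_fuel : regs p r r' e e' c c' f .fuel = f := rfl

@[simp] theorem stackSize_regs : stackSize (regs p r r' e e' c c' f) = p.length + r.length +
    r'.length + e.length + e'.length + c.length + c'.length + f.length := by
  have : (Finset.univ : Finset Reg) = {.pending, .row, .rowDone, .label, .labelDone, .cols,
    .colsDone, .fuel} := rfl
  simp [stackSize, this]
  ring

end

theorem stackSize_update (S : Store) (k : Reg) (x : List Sym) :
    stackSize (Function.update S k x) + (S k).length = stackSize S + x.length := by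
  rw [eq_regs S]
  cases k <;> simp <;> lia

theorem bounded_move {X Y : Reg} (h : X ≠ Y) : (move X Y).Bounded {X, Y} := by
  refine Bounded.loop X (T' := ∅) (fun v S => ?_) (fun _ => .skip) (by simp) (by simp)
  have h₀ := stackSize_update S X (S X).tail
  cases hS : S X with
  | nil =>
    simp only [hS] at h₀
    simp [setTop, hS] at h₀ ⊢
    exact ⟨h₀.le, fun k hk _ => by simp [Function.update_of_ne hk]⟩
  | cons a l =>
    have h₁ := stackSize_update (Function.update S X l) Y (a :: S Y)
    simp [setTop, topSym, hS, h.symm] at h₀ h₁ ⊢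
    refine ⟨by lia, fun k hk hk' => by simp [Function.update_of_ne hk, Function.update_of_ne hk'],
      by simp [Function.update_of_ne h]⟩

theorem bounded_drain (X : Reg) : (drain X).Bounded {X} := by
  refine Bounded.loop X (T' := ∅) (fun v S => ?_) (fun _ => .skip) (by simp) (by simp)
  have h₀ := stackSize_update S X (S X).tail
  cases hS : S X with
  | nil =>
    simp only [hS] at h₀
    simp [setTop, hS] at h₀ ⊢
    exact ⟨h₀.le, fun k hk => by simp [Function.update_of_ne hk]⟩
  | cons a l =>
    simp [setTop, hS] at h₀ ⊢
    exact ⟨by lia, fun k hk => by simp [Function.update_of_ne hk]⟩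

theorem bounded_drainAll : drainAll.Bounded Finset.univ :=
  ((bounded_drain _).seq <| (bounded_drain _).seq <| (bounded_drain _).seq <|
    (bounded_drain _).seq <| (bounded_drain _).seq <| (bounded_drain _).seq <|
    (bounded_drain _).seq (bounded_drain _)).mono (Finset.subset_univ _)

theorem bounded_loadRow : loadRow.Bounded {.pending, .row} := by
  refine Bounded.switch (fun v S => ?_) fun _ => Bounded.loop .pending (T' := ∅) (fun v S => ?_)
    (fun _ => .skip) (by simp) (by simp)
  · rw [eq_regs S]
    constructor
    · cases S .row <;> cases S .pending <;> simp [setTop]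
    · intro k hk
      cases k <;> cases S .row <;> simp_all [setTop]
  · rw [eq_regs S]
    refine ⟨?_, fun k hk => ?_, ?_⟩
    · rcases S .pending with _ | ⟨_ | _ | _, l⟩ <;> simp [setTop, isBit]; lia
    · rcases S .pending with _ | ⟨_ | _ | _, l⟩ <;> cases k <;> simp_all [setTop, isBit]
    · rcases S .pending with _ | ⟨_ | _ | _, l⟩ <;> simp [setTop, isBit]

-- Every pushed symbol is paid for by a popped one. In particular the tick that raises a price is
-- paid for by the tick popped from the label. Each iteration consumes a symbol of `cols`.
set_option maxHeartbeats 1000000 in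
theorem bounded_scanStmt (v : Ctl) (S : Store) :
    stackSize (TM2.stepAux scanStmt v S).stk ≤ stackSize S ∧
    (∀ k ∉ ({.row, .rowDone, .label, .labelDone, .cols, .colsDone} : Finset Reg),
      (TM2.stepAux scanStmt v S).stk k = S k) ∧
    ((TM2.stepAux scanStmt v S).l ≠ none →
      ((TM2.stepAux scanStmt v S).stk .cols).length < (S .cols).length) := by
  rw [eq_regs S]
  generalize S .pending = p, S .row = r, S .rowDone = r', S .label = e, S .labelDone = e',
    S .cols = c, S .colsDone = c', S .fuel = f
  have aux : ∀ T : Store, stackSize T ≤ p.length + r.length + r'.length + e.length + e'.length +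
      c.length + c'.length + f.length → T .pending = p → T .fuel = f →
      stackSize T ≤ stackSize (regs p r r' e e' c c' f) ∧
      (∀ k ∉ ({.row, .rowDone, .label, .labelDone, .cols, .colsDone} : Finset Reg),
        T k = regs p r r' e e' c c' f k) := by
    intro T h₁ h₂ h₃
    refine ⟨by simpa using h₁, fun k hk => ?_⟩
    cases k <;> simp_all
  rw [← and_assoc]
  rcases v with ⟨o, _ | _ | _⟩ <;> rcases c with _ | ⟨_ | _ | _, c⟩ <;>
    rcases r with _ | ⟨_ | _ | (_ | _), r⟩ <;> rcases e with _ | ⟨_, e⟩ <;>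
    (refine ⟨aux _ ?_ ?_ ?_, ?_⟩ <;> simp [scanStmt, setTop, isBit, topSym] <;> lia)

/-- The stack `cols` is missing from the set: its length can therefore serve as the loop counter of
`scan`. The stack `fuel` plays the same role for the auction. -/
theorem bounded_scanBody (i : Option Bool) :
    (scanBody i).Bounded {.row, .rowDone, .label, .labelDone, .colsDone} := by
  rcases i with _ | _ | _
  · exact Bounded.skip.mono (by decide)
  · exact (bounded_move (by decide)).mono (by decide)
  · refine ((bounded_move (by decide)).seq <| (Bounded.op (T := {.label}) fun v S => ?_).seq <|
      (bounded_move (by decide)).seq (bounded_move (by decide))).mono (by decide)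
    have := stackSize_update S .label (S .label).tail
    simp at this ⊢
    exact ⟨by lia, fun k hk => by simp [Function.update_of_ne hk]⟩

theorem bounded_scan : scan.Bounded {.row, .rowDone, .label, .labelDone, .cols, .colsDone} :=
  Bounded.loop .cols bounded_scanStmt bounded_scanBody (by decide) (by decide)

theorem bounded_bid : bid.Bounded (Finset.univ.erase .fuel) :=
  (bounded_loadRow.seq <| bounded_scan.seq <| (bounded_move (by decide)).seq <|
    (bounded_move (by decide)).seq <|
    Bounded.op (T := ∅) fun _ _ => ⟨le_rfl, fun _ _ => rfl⟩).mono (by decide)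

theorem bounded_auction : auction.Bounded Finset.univ := by
  refine Bounded.loop .fuel (fun v S => ?_) (fun _ => bounded_bid) (by decide) (by decide)
  rw [eq_regs S]
  cases S .fuel <;> simp [setTop]
  lia

end Auction

/-! ### Results of routines, without time bounds -/

namespace Routine

variable {K σ : Type} {Γ : K → Type} [DecidableEq K]

/-- Started on the memory `c`, the routine `A` halts with the memory `c'`. -/
def Leads (A : Routine Γ σ) (c c' : Memory Γ σ) : Prop := ∃ t, A.Runs c c' t

variable {A B : Routine Γ σ} {c d e : Memory Γ σ}

theorem Leads.seq (hA : A.Leads c d) (hB : B.Leads d e) : (A.seq B).Leads c e := by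
  obtain ⟨s, hA⟩ := hA
  obtain ⟨t, hB⟩ := hB
  exact ⟨_, hA.seq hB⟩

theorem Leads.op {q : TM2.Stmt Γ Empty σ} (h : TM2.stepAux q c.1 c.2 = ⟨none, d.1, d.2⟩) :
    (op q).Leads c d := ⟨_, Runs.op h⟩

theorem Leads.skip : (skip : Routine Γ σ).Leads c c := ⟨_, Runs.skip⟩

variable {ι : Type} [Fintype ι] {q : TM2.Stmt Γ ι σ} {C : ι → Routine Γ σ}

theorem Leads.switch_halt (h : TM2.stepAux q c.1 c.2 = ⟨none, d.1, d.2⟩) :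
    (switch q C).Leads c d := ⟨_, Runs.switch_halt h⟩

theorem Leads.switch_goto {i : ι} (h : TM2.stepAux q c.1 c.2 = ⟨some i, d.1, d.2⟩)
    (hC : (C i).Leads d e) : (switch q C).Leads c e := by
  obtain ⟨t, hC⟩ := hC
  exact ⟨_, Runs.switch_goto h hC⟩

theorem Leads.loop_halt (h : TM2.stepAux q c.1 c.2 = ⟨none, d.1, d.2⟩) :
    (loop q C).Leads c d := ⟨_, Runs.loop_halt h⟩

theorem Leads.loop_goto {i : ι} {c' : Memory Γ σ}
    (h : TM2.stepAux q c.1 c.2 = ⟨some i, d.1, d.2⟩) (hC : (C i).Leads d e)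
    (hL : (loop q C).Leads e c') : (loop q C).Leads c c' := by
  obtain ⟨t, hC⟩ := hC
  obtain ⟨t', hL⟩ := hL
  exact ⟨_, Runs.loop_goto h hC hL⟩

/-- By determinism the run that exists by boundedness is the run whose result is known, so a result
proved without any time count inherits the polynomial bound. -/
theorem Bounded.runs [Fintype K] {T : Finset K} (h : A.Bounded T) :
    ∃ p : Polynomial ℕ, ∀ c d, A.Leads c d →
      A.Runs c d (p.eval (stackSize c.2)) ∧ stackSize d.2 ≤ stackSize c.2 := by
  obtain ⟨p, hp⟩ := h
  refine ⟨p, fun c d ⟨t, hd⟩ => ?_⟩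
  obtain ⟨c', h, h', -⟩ := hp c
  rw [hd.unique h]
  exact ⟨h, h'⟩

end Routine

/-! ### Effect of the scan on the columns -/

namespace Auction

open Routine

theorem leads_move {X Y : Reg} (h : X ≠ Y) (o : Option Sym) (m : Mode) (S : Store) :
    (move X Y).Leads ((o, m), S)
      ((none, m), Function.update (Function.update S X []) Y ((S X).reverse ++ S Y)) := by
  generalize hx : S X = x
  induction x generalizing S o with
  | nil =>
    refine Leads.loop_halt ?_
    simp only [setTop, TM2.stepAux, hx, List.head?_nil, List.tail_nil, Option.isSome_none,
      cond_false, List.reverse_nil, List.nil_append]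
    rw [← Function.update_of_ne h.symm ([] : List Sym) S, Function.update_eq_self]
  | cons a x ih =>
    have h₁ := ih (some a) (Function.update (Function.update S X x) Y (a :: S Y))
      (by simp [Function.update_of_ne h])
    have h₂ : Function.update (Function.update (Function.update (Function.update S X x) Y
        (a :: S Y)) X []) Y (x.reverse ++ Function.update (Function.update S X x) Y (a :: S Y) Y) =
        Function.update (Function.update S X []) Y ((a :: x).reverse ++ S Y) := by
      funext k
      by_cases hY : k = Y
      · subst hY; simp
      · by_cases hX : k = X
        · subst hX; simp [hY]
        · simp [hX, hY]
    rw [h₂] at h₁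
    refine Leads.loop_goto (d := ((some a, m),
      Function.update (Function.update S X x) Y (a :: S Y))) (i := ()) ?_ Leads.skip h₁
    simp [setTop, hx, topSym, Function.update_of_ne h.symm]

theorem leads_drain (X : Reg) (o : Option Sym) (m : Mode) (S : Store) :
    (drain X).Leads ((o, m), S) ((none, m), Function.update S X []) := by
  generalize hx : S X = x
  induction x generalizing S o with
  | nil =>
    refine Leads.loop_halt ?_
    simp [setTop, hx]
  | cons a x ih =>
    have h₁ := ih (some a) (Function.update S X x) (by simp)
    rw [Function.update_idem] at h₁
    refine Leads.loop_goto (d := ((some a, m), Function.update S X x)) (i := ()) ?_ Leads.skip h₁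
    simp [setTop, hx]

theorem leads_drainAll (o : Option Sym) (m : Mode) (S : Store) :
    drainAll.Leads ((o, m), S) ((none, m), fun _ => []) := by
  have : (fun _ => []) = regs [] [] [] [] [] [] [] [] := by funext k; cases k <;> rfl
  rw [this, eq_regs S]
  refine (leads_drain _ _ _ _).seq <| (leads_drain _ _ _ _).seq <| (leads_drain _ _ _ _).seq <|
    (leads_drain _ _ _ _).seq <| (leads_drain _ _ _ _).seq <| (leads_drain _ _ _ _).seq <|
    (leads_drain _ _ _ _).seq ?_
  have := leads_drain .fuel none m (regs [] [] [] [] [] [] [] (S .fuel))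
  simpa using this

section scan

variable (p r r' e e' c c' f : List Sym) (o : Option Sym) {d : Memory (fun _ : Reg => Sym) Ctl}

theorem scan_nil (m : Mode) :
    scan.Leads ((o, m), regs p r r' e e' [] c' f) ((none, m), regs p r r' e e' [] c' f) :=
  Leads.loop_halt (by simp [scanStmt, setTop])

variable {p r r' e e' c c' f o}

theorem scan_goto {v v' : Ctl} {S S' : Store} {e : Memory (fun _ : Reg => Sym) Ctl}
    {i : Option Bool} (h : TM2.stepAux scanStmt v S = ⟨some i, v', S'⟩)
    (hB : (scanBody i).Leads (v', S') e) (hL : scan.Leads e d) : scan.Leads (v, S) d :=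
  Leads.loop_goto (d := (v', S')) h hB hL

/-- This and the following lemmas are in continuation form: the rest of the scan is a hypothesis,
for any symbol `o` read last, since that symbol is overwritten before it is used. -/
theorem scan_tick_cons
    (h : ∀ o, scan.Leads ((o, .scan), regs p r r' e (.tick :: e') c (.tick :: c') f) d) :
    scan.Leads ((o, .scan), regs p r r' (.tick :: e) e' (.tick :: c) c' f) d := by
  refine scan_goto (i := none) (v' := (some .tick, .scan)) ?_ Leads.skip (h _)
  simp [scanStmt, setTop, isBit, topSym]

theorem scan_tick_nil
    (h : ∀ o, scan.Leads ((o, .scan), regs p r r' [] e' c (.tick :: c') f) d) :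
    scan.Leads ((o, .scan), regs p r r' [] e' (.tick :: c) c' f) d := by
  refine scan_goto (i := none) (v' := (none, .scan)) ?_ Leads.skip (h _)
  simp [scanStmt, setTop, isBit, topSym]

theorem scan_bits (l : List Bool)
    (h : ∀ o, scan.Leads ((o, .scan), regs p r r' e e' c ((l.map .bit).reverse ++ c') f) d) :
    scan.Leads ((o, .scan), regs p r r' e e' (l.map .bit ++ c) c' f) d := by
  induction l generalizing c' o with
  | nil => exact h _
  | cons b l ih =>
    refine scan_goto (i := none) (v' := (some (.bit b), .scan)) ?_ Leads.skip
      (ih (c' := .bit b :: c') ?_)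
    · simp [scanStmt, setTop, isBit, topSym]
    · simpa using h

-- In mode `swap` the head is not a bit once the row of the former owner has been removed; the next
-- symbol then switches the mode to `done`.
variable (p r r' e e' c c' f) in
theorem scan_copy (m : Mode) (hm : m = .done ∨ m = .swap ∧ isBit c.head? = false) :
    ∃ m', ∀ o, scan.Leads ((o, m), regs p r r' e e' c c' f)
      ((none, m'), regs p r r' e e' [] (c.reverse ++ c') f) := by
  induction c generalizing c' m with
  | nil => exact ⟨m, fun o => scan_nil ..⟩
  | cons a c ih =>
    obtain ⟨m', h⟩ := ih (a :: c') .done (.inl rfl)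
    rw [← List.singleton_append, ← List.append_assoc, ← List.reverse_cons] at h
    refine ⟨m', fun o => scan_goto (i := none) (v' := (some a, .done)) ?_ Leads.skip (h _)⟩
    rcases hm with rfl | ⟨rfl, hc⟩
    · simp [scanStmt, setTop, topSym]
    · rw [List.head?_cons] at hc
      simp [scanStmt, setTop, topSym, hc]

theorem scan_swap_bits (l : List Bool)
    (h : ∀ o, scan.Leads ((o, .swap), regs p r ((l.map .bit).reverse ++ r') e e' c c' f) d) :
    scan.Leads ((o, .swap), regs p r r' e e' (l.map .bit ++ c) c' f) d := by
  induction l generalizing r' o with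
  | nil => exact h _
  | cons b l ih =>
    refine scan_goto (i := none) (v' := (some (.bit b), .swap)) ?_ Leads.skip
      (ih (r' := .bit b :: r') ?_)
    · simp [scanStmt, setTop, isBit, topSym]
    · simpa using h

/-- Unary comparison of offer and price: each tick of the price cancels a tick of the label while
there is one, so a label remains exactly when `q < a`. -/
theorem scan_ticks (a b q : ℕ)
    (h : ∀ o, scan.Leads ((o, .scan), regs p r r' (.replicate (a - q) .tick)
      (.replicate (min a q + b) .tick) c (.replicate q .tick ++ c') f) d) :
    scan.Leads ((o, .scan), regs p r r' (.replicate a .tick) (.replicate b .tick)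
      (.replicate q .tick ++ c) c' f) d := by
  induction q generalizing a b c' o with
  | zero => simpa using h o
  | succ q ih =>
    have hq : List.replicate (q + 1) Sym.tick ++ c' =
      List.replicate q Sym.tick ++ Sym.tick :: c' := by
      rw [List.replicate_succ', List.append_assoc]; rfl
    rw [hq] at h
    cases a with
    | zero => exact scan_tick_nil fun o => ih 0 b (by simpa using h)
    | succ a =>
      refine scan_tick_cons fun o => ih a (b + 1) fun o => ?_
      rw [show min a q + (b + 1) = min (a + 1) (q + 1) + b by lia, ← Nat.add_sub_add_right a 1 q]
      exact h o

/-- The common part of all cases in which the column is left alone. The hypothesis `hs` isolates the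
reason, which shows at the separator; afterwards the label is restored. -/
theorem scan_column_pass (a q : ℕ) (l : List Bool) {r₁ r₁' : List Sym}
    (hs : ∀ o, ∃ o', ∀ c c', TM2.stepAux scanStmt (o, .scan) (regs p r r' (.replicate (a - q) .tick)
      (.replicate (min a q) .tick) (.mid :: c) c' f) = ⟨some false, (o', .scan), regs p r₁ r₁'
        (.replicate (a - q) .tick) (.replicate (min a q) .tick) c (.mid :: c') f⟩)
    (h : ∀ o, scan.Leads ((o, .scan), regs p r₁ r₁' (.replicate a .tick) [] c
      ((.replicate q .tick ++ .mid :: l.map .bit).reverse ++ c') f) d) :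
    scan.Leads ((o, .scan), regs p r r' (.replicate a .tick) []
      (.replicate q .tick ++ .mid :: l.map .bit ++ c) c' f) d := by
  rw [List.append_assoc]
  refine scan_ticks (b := 0) a q fun o => ?_
  obtain ⟨o', hs⟩ := hs o
  have hm := leads_move (X := .labelDone) (Y := .label) (by decide)
    o' .scan (regs p r₁ r₁' (.replicate (a - q) .tick)
      (.replicate (min a q) .tick) (l.map .bit ++ c) (.mid :: (.replicate q .tick ++ c')) f)
  have ha : min a q + (a - q) = a := by lia
  simp only [update_labelDone, update_label, regs_label, regs_labelDone, List.reverse_replicate,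
    ← List.replicate_add, ha] at hm
  exact scan_goto (hs _ _) hm (scan_bits l (by simpa using h))

/-- A column that is not available to the current row. -/
theorem scan_column_skip (a q : ℕ) (b : Bool) (l : List Bool) (hb : b = true → a ≤ q)
    (h : ∀ o, scan.Leads ((o, .scan), regs p r (.bit b :: r') (.replicate a .tick) [] c
      ((.replicate q .tick ++ .mid :: l.map .bit).reverse ++ c') f) d) :
    scan.Leads ((o, .scan), regs p (.bit b :: r) r' (.replicate a .tick) []
      (.replicate q .tick ++ .mid :: l.map .bit ++ c) c' f) d := by
  refine scan_column_pass a q l (fun o => ?_) h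
  cases b with
  | false =>
    refine ⟨some (.bit false), fun c c' => ?_⟩
    simp [scanStmt, setTop, isBit, topSym]
  | true =>
    refine ⟨none, fun c c' => ?_⟩
    simp [scanStmt, setTop, isBit, topSym, Nat.sub_eq_zero_of_le (hb rfl)]

/-- A column that is available to the current row. -/
theorem scan_column_take (a q : ℕ) (l : List Bool) (hq : q < a) (hc : isBit c.head? = false) :
    ∃ m', ∀ o, scan.Leads ((o, .scan), regs p (.bit true :: r) r' (.replicate a .tick) []
      (.replicate q .tick ++ .mid :: l.map .bit ++ c) c' f)
      ((none, m'), regs p [] (l.map .bit).reverse (.replicate (a - 2) .tick) [] []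
        ((.replicate (q + 1) .tick ++ .mid :: (r'.reverse ++ .bit true :: r) ++ c).reverse ++ c')
        f) := by
  obtain ⟨k, rfl⟩ := Nat.exists_eq_add_of_lt hq
  -- The scanned part, which is reversed: `c₁` ends with the price raised to `q + 1`, and `c₂` adds
  -- the row of the bidder as the new owner.
  let c₁ := .mid :: .tick :: (.replicate q .tick ++ c')
  let c₂ := (r'.reverse ++ .bit true :: r).reverse ++ c₁
  obtain ⟨m', hcopy⟩ := scan_copy p [] (l.map .bit).reverse (.replicate (q + k + 1 - 2) .tick) [] c
    c₂ f .swap (.inr ⟨rfl, hc⟩)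
  refine ⟨m', fun o => ?_⟩
  rw [List.append_assoc]
  refine scan_ticks (b := 0) _ q fun o => ?_
  have hk : q + k + 1 - q = k + 1 := by lia
  have hq : min (q + k + 1) q + 0 = q := by lia
  rw [hk, hq]
  have h₁ := leads_move (X := .labelDone) (Y := .label) (by decide) (some .tick) .swap
    (regs p r (.bit true :: r') (.replicate k .tick) (.replicate q .tick) (l.map .bit ++ c) c₁ f)
  -- The second of the two ticks that leave the label; the first was popped by the comparison. Here
  -- the label may already be empty, in agreement with truncated subtraction.
  have h₂ : (op (.pop .label setTop .halt) : ARoutine).Leads ((none, .swap),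
      regs p r (.bit true :: r') (.replicate (q + k) .tick) [] (l.map .bit ++ c) c₁ f)
      (((List.replicate (q + k) Sym.tick).head?, .swap),
      regs p r (.bit true :: r') (.replicate (q + k - 1) .tick) [] (l.map .bit ++ c) c₁ f) :=
    Leads.op (by simp [setTop])
  have h₃ := leads_move (X := .rowDone) (Y := .row) (by decide)
    (List.replicate (q + k) Sym.tick).head? .swap
    (regs p r (.bit true :: r') (.replicate (q + k - 1) .tick) [] (l.map .bit ++ c) c₁ f)
  have h₄ := leads_move (X := .row) (Y := .colsDone) (by decide) none .swap
    (regs p (r'.reverse ++ .bit true :: r) [] (.replicate (q + k - 1) .tick) []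
      (l.map .bit ++ c) c₁ f)
  simp only [update_labelDone, update_label, update_row, update_rowDone, update_colsDone,
    regs_label, regs_labelDone, regs_row, regs_rowDone, regs_colsDone, List.reverse_replicate,
    ← List.replicate_add, List.reverse_cons, List.append_assoc, List.singleton_append]
    at h₁ h₃ h₄
  have hB : (scanBody (some true)).Leads _ _ := h₁.seq (h₂.seq (h₃.seq h₄))
  refine scan_goto ?_ hB (scan_swap_bits l fun o => ?_)
  · simp [scanStmt, setTop, isBit, topSym, List.replicate_succ, c₁]
  · convert hcopy o using 3
    · simp
    · rfl
    · have : List.replicate q Sym.tick ++ Sym.tick :: c' =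
          Sym.tick :: (List.replicate q Sym.tick ++ c') := by
        rw [← List.cons_append, ← List.replicate_succ, List.replicate_succ', List.append_assoc]
        rfl
      simp [c₂, c₁, List.replicate_succ, this]

/-- The code of a column with price `x.1` that is assigned to the row `x.2`. -/
def encodeCol (x : ℕ × List Bool) : List Sym := .replicate x.1 .tick ++ .mid :: x.2.map .bit

/-- A column starts with a tick or a separator, so the end of the preceding owner's row can be
recognized. -/
theorem isBit_head_encodeCols (l : List (ℕ × List Bool)) :
    isBit (l.flatMap encodeCol).head? = false := by
  rcases l with _ | ⟨⟨_ | q, x⟩, l⟩ <;> simp [encodeCol, isBit, List.replicate_succ]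

theorem scan_columns_skip (a : ℕ) (l : List (ℕ × List Bool)) (b : List Bool)
    (hl : b.length = l.length)
    (hb : ∀ i (h : i < l.length), b[i] = true → a ≤ l[i].1)
    (h : ∀ o, scan.Leads ((o, .scan), regs p r ((b.map .bit).reverse ++ r') (.replicate a .tick) []
      c ((l.flatMap encodeCol).reverse ++ c') f) d) :
    scan.Leads ((o, .scan), regs p (b.map .bit ++ r) r' (.replicate a .tick) []
      (l.flatMap encodeCol ++ c) c' f) d := by
  induction l generalizing b r' c' o with
  | nil =>
    obtain rfl := List.length_eq_zero_iff.1 hl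
    exact h _
  | cons x l ih =>
    obtain _ | ⟨y, b⟩ := b
    · simp at hl
    · rw [List.flatMap_cons, List.append_assoc]
      refine scan_column_skip a x.1 y x.2 (fun hy => hb 0 (by simp) hy) fun o => ?_
      refine ih b (by simpa using hl) (fun i hi hbi => ?_) fun o => ?_
      · exact hb (i + 1) (by simpa using hi) hbi
      · convert h o using 3 <;> simp [encodeCol]

/-- After the matching is complete there is no bidder, and the scan changes nothing while the
remaining fuel is spent. -/
theorem scan_columns_idle (a : ℕ) (l : List (ℕ × List Bool))
    (h : ∀ o, scan.Leads ((o, .scan), regs p [] r' (.replicate a .tick) []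
      c ((l.flatMap encodeCol).reverse ++ c') f) d) :
    scan.Leads ((o, .scan), regs p [] r' (.replicate a .tick) []
      (l.flatMap encodeCol ++ c) c' f) d := by
  induction l generalizing c' o with
  | nil => exact h _
  | cons x l ih =>
    rw [List.flatMap_cons, List.append_assoc]
    refine scan_column_pass (r₁ := []) (r₁' := r') a x.1 x.2 (fun o => ⟨none, fun c c' => ?_⟩)
      fun o => ?_
    · simp [scanStmt, setTop, isBit]
    · refine ih fun o => ?_
      convert h o using 3
      simp [encodeCol]

end scan

/-! #### The effect of a step -/

section bid

variable (p r e f : List Sym) (cols : List (ℕ × List Bool)) (b : List Bool) (a : ℕ)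

theorem leads_loadRow_of_row (x : Sym) (c : List Sym) :
    loadRow.Leads ((some .tick, .scan), regs p (x :: r) [] e [] c [] f)
      ((none, .scan), regs p (x :: r) [] e [] c [] f) :=
  Leads.switch_halt (by simp [setTop])

theorem leads_loadRow (c : List Sym) (l : List Bool) (hp : isBit p.head? = false) :
    loadRow.Leads ((some .tick, .scan), regs (.mid :: (l.reverse.map .bit ++ p)) [] [] e [] c [] f)
      ((none, .scan), regs p (l.map .bit) [] e [] c [] f) := by
  refine Leads.switch_goto (i := ()) (d := ((some .mid, .scan),
    regs (l.reverse.map .bit ++ p) [] [] e [] c [] f)) (by simp [setTop]) ?_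
  suffices H : ∀ (l : List Bool) (r : List Sym) (o : Option Sym),
      (loop (ι := Unit) (.peek .pending setTop (.branch (fun v => isBit v.1)
      (.pop .pending setTop (.push .row topSym (.goto fun _ => ())))
      (.load (fun v => (none, v.2)) .halt))) fun _ => skip : ARoutine).Leads ((o, .scan),
      regs (l.map .bit ++ p) r [] e [] c [] f)
      ((none, .scan), regs p ((l.map .bit).reverse ++ r) [] e [] c [] f) by
    simpa using H l.reverse [] (some .mid)
  intro l
  induction l with
  | nil =>
    intro r o
    exact Leads.loop_halt (by simp [setTop, hp])
  | cons y l ih =>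
    intro r o
    have := ih (.bit y :: r) (some (.bit y))
    rw [← List.singleton_append, ← List.append_assoc, ← List.reverse_cons] at this
    refine Leads.loop_goto (i := ()) (d := ((some (.bit y), .scan),
      regs (l.map .bit ++ p) (.bit y :: r) [] e [] c [] f)) ?_ Leads.skip this
    simp [setTop, topSym, isBit]

theorem leads_loadRow_nil (c : List Sym) :
    loadRow.Leads ((some .tick, .scan), regs [] [] [] e [] c [] f)
      ((none, .scan), regs [] [] [] e [] c [] f) := by
  refine Leads.switch_goto (i := ()) (d := ((none, .scan),
    regs [] [] [] e [] c [] f)) (by simp [setTop]) (Leads.loop_halt ?_)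
  simp [setTop, isBit]

/-- What remains to be done after the scan of the columns. -/
def rewind : ARoutine :=
  (move .colsDone .cols).seq <| (move .rowDone .row).seq <|
    op (.load (fun _ => (none, .scan)) .halt)

theorem leads_rewind (m : Mode) (r' c' : List Sym) :
    rewind.Leads ((none, m), regs p [] r' e [] [] c' f)
      ((none, .scan), regs p r'.reverse [] e [] c'.reverse [] f) := by
  have h₁ := leads_move (X := .colsDone) (Y := .cols) (by decide) none m
    (regs p [] r' e [] [] c' f)
  have h₂ := leads_move (X := .rowDone) (Y := .row) (by decide) none m
    (regs p [] r' e [] c'.reverse [] f)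
  simp only [update_row, update_rowDone, update_colsDone, update_cols, regs_cols, regs_colsDone,
    regs_row, regs_rowDone, List.append_nil] at h₁ h₂
  exact h₁.seq (h₂.seq (Leads.op rfl))

theorem leads_scan_skip (hl : b.length = cols.length)
    (hb : ∀ i (h : i < cols.length), b[i] = true → a ≤ cols[i].1) :
    (scan.seq rewind).Leads ((none, .scan), regs p (b.map .bit) [] (.replicate a .tick) []
        (cols.flatMap encodeCol) [] f)
      ((none, .scan), regs p (b.map .bit) [] (.replicate a .tick) []
        (cols.flatMap encodeCol) [] f) := by
  have h₁ := scan_columns_skip (p := p) (r := []) (r' := []) (c := []) (c' := []) (f := f)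
    (o := none) a cols b hl hb fun o => scan_nil ..
  simp only [List.append_nil] at h₁
  simpa using h₁.seq (leads_rewind ..)

theorem leads_scan_nil :
    (scan.seq rewind).Leads ((none, .scan), regs p [] [] (.replicate a .tick) []
        (cols.flatMap encodeCol) [] f)
      ((none, .scan), regs p [] [] (.replicate a .tick) [] (cols.flatMap encodeCol) [] f) := by
  have h₁ := scan_columns_idle (p := p) (r' := []) (c := []) (c' := []) (f := f)
    (o := none) a cols fun o => scan_nil ..
  simp only [List.append_nil] at h₁
  simpa using h₁.seq (leads_rewind ..)

/-- The label contains one tick more than the offer at the start of the step, so `a - 2` is the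
offer minus one. The former owner's row becomes the current one; it is empty if the column was free.
-/
theorem leads_scan_take (hl : b.length = cols.length) (j : ℕ) (hj : j < cols.length)
    (hbj : b[j] = true) (hja : cols[j].1 < a)
    (hb : ∀ i (h : i < j), b[i] = true → a ≤ cols[i].1) :
    (scan.seq rewind).Leads ((none, .scan), regs p (b.map .bit) [] (.replicate a .tick) []
        (cols.flatMap encodeCol) [] f)
      ((none, .scan), regs p (cols[j].2.map .bit) [] (.replicate (a - 2) .tick) []
        ((cols.set j (cols[j].1 + 1, b)).flatMap encodeCol) [] f) := by
  have hc : cols = cols.take j ++ cols[j] :: cols.drop (j + 1) := by simp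
  have hb' : b = b.take j ++ true :: b.drop (j + 1) := by
    have : b = b.take j ++ b[j] :: b.drop (j + 1) := by simp
    rwa [hbj] at this
  obtain ⟨m', h⟩ := scan_column_take (p := p) (r := (b.drop (j + 1)).map .bit)
    (r' := ((b.take j).map .bit).reverse) (c := (cols.drop (j + 1)).flatMap encodeCol)
    (c' := ((cols.take j).flatMap encodeCol).reverse) (f := f) a cols[j].1 cols[j].2 hja
    (isBit_head_encodeCols _)
  have h₁ := scan_columns_skip (p := p) (r := .bit true :: (b.drop (j + 1)).map .bit) (r' := [])
    (c := encodeCol cols[j] ++ (cols.drop (j + 1)).flatMap encodeCol) (c' := []) (f := f)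
    (o := none) a (cols.take j) (b.take j) (by simp [hl])
    (fun i hi hbi => by
      simp only [List.length_take, lt_min_iff] at hi
      simpa using hb i hi.1 (by simpa using hbi))
    (fun o => by simpa [encodeCol] using h o)
  have h₂ := h₁.seq (leads_rewind ..)
  convert h₂ using 4
  · conv_lhs => rw [hb']
    simp
  · rw [← List.flatMap_cons, ← List.flatMap_append, ← hc]
  · simp
  · rw [List.set_eq_take_append_cons_drop, if_pos hj]
    conv_lhs => rw [hb']
    simp [encodeCol]

end bid

end Auction

namespace Auction

open Routine

/-! ### Correctness of the auction -/

/-- The state of an auction in which `n` rows bid for `n` columns. -/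
structure State (n : ℕ) where
  /-- the rows that are waiting -/
  pending : List (Fin n)
  /-- the row that is bidding -/
  cur : Option (Fin n)
  /-- the price that the bidding row offers -/
  label : ℕ
  /-- the prices of the columns -/
  price : Fin n → ℕ
  /-- the rows to which the columns are assigned -/
  owner : Fin n → Option (Fin n)

/-- A perfect matching: a permutation supported on the entries `true` of `A`. -/
def HasPerm {n : ℕ} (A : Fin n → Fin n → Bool) : Prop :=
  ∃ π : Equiv.Perm (Fin n), ∀ i, A i (π i) = true

variable {n : ℕ} (A : Fin n → Fin n → Bool)

/-- The invariants of an auction. -/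
structure State.Inv (s : State n) : Prop where
  cur_le : ∀ i, s.cur = some i → ∀ j, A i j = true → s.label ≤ s.price j
  label_eq : s.cur = none → s.pending ≠ [] → s.label = 0
  adj : ∀ j i, s.owner j = some i → A i j = true
  one_le : ∀ j i, s.owner j = some i → 1 ≤ s.price j
  price_le : ∀ j i, s.owner j = some i → ∀ j', A i j' = true → s.price j ≤ s.price j' + 1
  free : ∀ j, s.owner j = none → s.price j = 0
  complete : ∀ i, i ∈ s.pending ∨ s.cur = some i ∨ ∃ j, s.owner j = some i
  nodup : s.pending.Nodup
  inj : ∀ j j' i, s.owner j = some i → s.owner j' = some i → j = j'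
  cur_free : ∀ i, s.cur = some i → ∀ j, s.owner j ≠ some i
  pending_free : ∀ i ∈ s.pending, s.cur ≠ some i ∧ ∀ j, s.owner j ≠ some i
  price_bound : HasPerm A → ∀ j, s.price j ≤ n + 1

/-- All rows are assigned to columns. -/
def State.Done (s : State n) : Prop := s.cur = none ∧ s.pending = []

/-- The progress of an auction. -/
def State.progress (s : State n) : ℕ := 2 * ∑ j, s.price j + s.label

variable {A}

/-- By Hall's condition, prices do not skip a level. -/
theorem State.Inv.label_le {s : State n} (h : s.Inv A) {i₀ : Fin n} (hi₀ : s.cur = some i₀)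
    (hA : HasPerm A) : s.label ≤ n := by
  obtain ⟨π, hπ⟩ := hA
  -- Columns with a positive price have owners, distinct columns have distinct owners, and `i₀` owns
  -- nothing: at most `n - 1` positive prices occur, so one of `1, …, n` is missing.
  obtain ⟨k, hk₁, hk⟩ : ∃ k ∈ Finset.Icc 1 n, ∀ j, s.price j ≠ k := by
    by_contra! hcon
    have : Nonempty (Fin n) := ⟨i₀⟩
    choose! f hf using hcon
    have howned : ∀ k ∈ Finset.Icc 1 n, ∃ i, s.owner (f k) = some i := by
      intro k hk
      rw [← Option.ne_none_iff_exists']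
      intro hn
      have := h.free _ hn
      rw [hf k hk] at this
      simp [this] at hk
    choose! g hg using howned
    have hinj : Set.InjOn g (Finset.Icc 1 n) := by
      intro k hk k' hk' he
      have := h.inj _ _ (g k) (hg k hk) (by rw [he]; exact hg k' hk')
      rw [← hf k hk, ← hf k' hk', this]
    have hcard := Finset.card_le_card_of_injOn (s := Finset.Icc 1 n)
      (t := Finset.univ.erase i₀) g
      (fun k hk => by simpa using fun he : g k = i₀ => h.cur_free _ hi₀ (f k) (he ▸ hg k hk)) hinj
    have := i₀.pos
    rw [Finset.card_erase_of_mem (Finset.mem_univ _), Nat.card_Icc, Finset.card_univ,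
      Fintype.card_fin] at hcard
    lia
  by_contra! hlt
  rw [Finset.mem_Icc] at hk₁
  -- If the offer exceeded `n`, the columns above the gap `k` would violate Hall's condition.
  let C : Finset (Fin n) := {j | k < s.price j}
  have howned : ∀ j ∈ C, ∃ i, s.owner j = some i := by
    intro j hj
    rw [← Option.ne_none_iff_exists']
    intro hn
    have := h.free _ hn
    simp [C] at hj
    lia
  choose! g hg using howned
  have hi : i₀ ∉ C.image g := by
    simp only [Finset.mem_image, not_exists, not_and]
    intro j hj he
    exact h.cur_free _ hi₀ j (he ▸ hg j hj)
  have hcard : (insert i₀ (C.image g)).card = C.card + 1 := by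
    rw [Finset.card_insert_of_notMem hi, Finset.card_image_of_injOn]
    intro j hj j' hj' he
    exact h.inj _ _ (g j) (hg j hj) (by rw [he]; exact hg j' hj')
  -- An owner of a column in `C` sees only prices at least `k`, hence above `k`; the bidder sees
  -- only prices at least its offer. So `C.card + 1` rows have all their neighbours in `C`.
  have hmaps : Set.MapsTo π (insert i₀ (C.image g) : Finset (Fin n)) (C : Set (Fin n)) := by
    intro i hi
    simp only [Finset.coe_insert, Finset.coe_image, Set.mem_insert_iff, Set.mem_image,
      Finset.mem_coe] at hi
    simp only [C, Finset.coe_filter, Finset.mem_univ, true_and, Set.mem_ofPred_eq]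
    rcases hi with rfl | ⟨j, hj, rfl⟩
    · have := h.cur_le _ hi₀ _ (hπ i)
      lia
    · have h₁ := h.price_le _ _ (hg j hj) _ (hπ (g j))
      have h₂ := hk (π (g j))
      simp [C] at hj
      lia
  have := Finset.card_le_card_of_injOn π hmaps π.injective.injOn
  lia

theorem State.Inv.progress_le {s : State n} (h : s.Inv A) (hA : HasPerm A) (hs : ¬ s.Done) :
    s.progress ≤ 2 * (n * (n + 1)) + n := by
  have h₁ : s.label ≤ n := by
    cases hc : s.cur with
    | some i => exact h.label_le hc hA
    | none => rw [h.label_eq hc fun hp => hs ⟨hc, hp⟩]; exact n.zero_le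
  have h₂ : ∑ j, s.price j ≤ n * (n + 1) := by
    simpa using Finset.sum_le_card_nsmul Finset.univ s.price (n + 1)
      fun j _ => h.price_bound hA j
  unfold State.progress
  lia

theorem State.Inv.hasPerm {s : State n} (h : s.Inv A) (hs : s.Done) : HasPerm A := by
  have : ∀ i, ∃ j, s.owner j = some i := fun i => by
    simpa [hs.1, hs.2] using h.complete i
  choose f hf using this
  have hinj : f.Injective := fun i i' he => by
    have := hf i
    rw [he, hf i'] at this
    exact (Option.some_inj.1 this).symm
  exact ⟨.ofBijective f (Finite.injective_iff_bijective.1 hinj), fun i => h.adj _ _ (hf i)⟩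

/-- The initial state. -/
def State.init (n : ℕ) (l : List (Fin n)) : State n := ⟨l, none, 0, fun _ => 0, fun _ => none⟩

theorem State.inv_init {l : List (Fin n)} (hl : l.Nodup) (hl' : ∀ i, i ∈ l) :
    (State.init n l).Inv A := by
  constructor <;> simp [State.init, hl, hl']

/-- The first waiting row starts bidding. -/
theorem State.Inv.load {l : List (Fin n)} {i : Fin n} {e : ℕ} {p : Fin n → ℕ}
    {o : Fin n → Option (Fin n)} (h : State.Inv A ⟨i :: l, none, e, p, o⟩) :
    State.Inv A ⟨l, some i, e, p, o⟩ := by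
  obtain ⟨h₁, h₂, h₃, h₄, h₅, h₆, h₇, h₈, h₉, h₁₀, h₁₁, h₁₂⟩ := h
  simp only [reduceCtorEq, IsEmpty.forall_iff, ne_eq, not_false_eq_true, forall_const,
    List.mem_cons, false_or, List.nodup_cons, forall_eq_or_imp] at *
  refine ⟨?_, ?_, h₃, h₄, h₅, h₆, ?_, h₈.2, h₉, ?_, ?_, h₁₂⟩ <;> dsimp only
  · intro _ _ _ _; simp [h₂]
  · simp
  · intro i'
    rcases h₇ i' with (rfl | h) | h
    · simp
    · exact .inl h
    · exact .inr (.inr h)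
  · rintro _ ⟨⟩
    simpa using h₁₁.1
  · intro i' hi'
    refine ⟨?_, by simpa using h₁₁.2 i' hi'⟩
    rintro ⟨⟩
    exact h₈.1 hi'

/-- The bidding row takes a column. -/
theorem State.Inv.take {l : List (Fin n)} {i j : Fin n} {e : ℕ} {p : Fin n → ℕ}
    {o : Fin n → Option (Fin n)} (h : State.Inv A ⟨l, some i, e, p, o⟩) (hj : A i j = true)
    (hp : p j ≤ e) :
    State.Inv A ⟨l, o j, e - 1, Function.update p j (p j + 1), Function.update o j (some i)⟩ := by
  have hbound := fun hA => h.label_le (i₀ := i) rfl hA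
  obtain ⟨h₁, h₂, h₃, h₄, h₅, h₆, h₇, h₈, h₉, h₁₀, h₁₁, h₁₂⟩ := h
  dsimp only at *
  have hle : ∀ j', p j' ≤ Function.update p j (p j + 1) j' := by
    intro j'
    rcases eq_or_ne j' j with rfl | hne
    · simp
    · simp [hne]
  -- A purchase always happens at the exact offer: the bidder's invariant excludes cheaper columns
  -- in its support.
  have hpe : p j = e := le_antisymm hp (h₁ i rfl j hj)
  refine ⟨?_, ?_, ?_, ?_, ?_, ?_, ?_, h₈, ?_, ?_, ?_, ?_⟩ <;> dsimp only
  · intro i' hi' j' hj'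
    have := h₅ j i' hi' j' hj'
    have := hle j'
    lia
  -- A free column costs `0`, so the offer was `0` and remains `0` by truncation, ready for the next
  -- waiting row.
  · intro hn _
    rw [← hpe, h₆ j hn]
  · intro j' i' h
    rcases eq_or_ne j' j with rfl | hne
    · simp at h; exact h ▸ hj
    · rw [Function.update_of_ne hne] at h; exact h₃ _ _ h
  · intro j' i' h
    rcases eq_or_ne j' j with rfl | hne
    · simp
    · rw [Function.update_of_ne hne] at h ⊢; exact h₄ _ _ h
  · intro j' i' h j'' h''
    have := hle j''
    rcases eq_or_ne j' j with rfl | hne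
    · simp only [Function.update_self, Option.some_inj] at h ⊢
      subst h
      have := h₁ i rfl j'' h''
      lia
    · rw [Function.update_of_ne hne] at h
      have := h₅ _ _ h _ h''
      rw [Function.update_of_ne hne]
      lia
  · intro j' h
    rcases eq_or_ne j' j with rfl | hne
    · simp at h
    · rw [Function.update_of_ne hne] at h ⊢; exact h₆ _ h
  · intro i'
    rcases h₇ i' with h | h | ⟨j', h⟩
    · exact .inl h
    · exact .inr (.inr ⟨j, by simpa using h⟩)
    · rcases eq_or_ne j' j with rfl | hne
      · exact .inr (.inl h)
      · exact .inr (.inr ⟨j', by rwa [Function.update_of_ne hne]⟩)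
  · intro j' j'' i' h h'
    rcases eq_or_ne j' j with rfl | hne <;> rcases eq_or_ne j'' j' with rfl | hne'
    · rfl
    · rw [Function.update_of_ne hne'] at h'
      rw [Function.update_self] at h
      exact absurd h' (h₁₀ i' h j'')
    · rfl
    · rcases eq_or_ne j'' j with rfl | hne''
      · rw [Function.update_of_ne hne] at h
        rw [Function.update_self] at h'
        exact absurd h (h₁₀ i' h' j')
      · rw [Function.update_of_ne hne] at h
        rw [Function.update_of_ne hne''] at h'
        exact h₉ _ _ _ h h'
  · intro i' hi' j' h
    rcases eq_or_ne j' j with rfl | hne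
    · rw [Function.update_self] at h
      exact h₁₀ i' h j' hi'
    · rw [Function.update_of_ne hne] at h
      exact hne (h₉ _ _ _ h hi')
  · intro i' hi'
    obtain ⟨g₁, g₂⟩ := h₁₁ i' hi'
    refine ⟨g₂ j, fun j' => ?_⟩
    rcases eq_or_ne j' j with rfl | hne
    · rwa [Function.update_self]
    · rw [Function.update_of_ne hne]; exact g₂ j'
  · intro hA j'
    rcases eq_or_ne j' j with rfl | hne
    · have := hbound hA
      simp
      lia
    · rw [Function.update_of_ne hne]; exact h₁₂ hA j'

/-- The bidding row raises its offer. -/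
theorem State.Inv.raise {l : List (Fin n)} {i : Fin n} {e : ℕ} {p : Fin n → ℕ}
    {o : Fin n → Option (Fin n)} (h : State.Inv A ⟨l, some i, e, p, o⟩)
    (hp : ∀ j, A i j = true → e < p j) : State.Inv A ⟨l, some i, e + 1, p, o⟩ := by
  obtain ⟨h₁, h₂, h₃, h₄, h₅, h₆, h₇, h₈, h₉, h₁₀, h₁₁, h₁₂⟩ := h
  refine ⟨?_, ?_, h₃, h₄, h₅, h₆, h₇, h₈, h₉, h₁₀, h₁₁, h₁₂⟩
  · rintro _ ⟨⟩
    exact hp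
  · simp

/-! ### States of the auction as contents of the stacks -/

variable (A)

/-- The bits of a row. -/
def rowBits (i : Fin n) : List Bool := List.ofFn (A i)

/-- The code of the waiting rows. -/
def encodePending (l : List (Fin n)) : List Sym :=
  l.flatMap fun i => .mid :: (rowBits A i).reverse.map .bit

/-- The columns with their prices and the rows to which they are assigned. -/
def colList (p : Fin n → ℕ) (o : Fin n → Option (Fin n)) : List (ℕ × List Bool) :=
  List.ofFn fun j => (p j, (o j).elim [] (rowBits A))

/-- The store of the auction machine that represents a state. -/
def State.store (s : State n) (f : List Sym) : Store :=
  regs (encodePending A s.pending) ((s.cur.elim [] (rowBits A)).map .bit) []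
    (.replicate s.label .tick) [] ((colList A s.price s.owner).flatMap encodeCol) [] f

variable {A}

theorem isBit_head_encodePending (l : List (Fin n)) :
    isBit (encodePending A l).head? = false := by
  cases l <;> simp [encodePending, isBit]

theorem set_colList (p : Fin n → ℕ) (o : Fin n → Option (Fin n)) (i j : Fin n) :
    (colList A p o).set j (p j + 1, rowBits A i) =
      colList A (Function.update p j (p j + 1)) (Function.update o j (some i)) := by
  refine List.ext_getElem (by simp [colList]) fun k h₁ h₂ => ?_
  rw [List.getElem_set]
  split_ifs with h
  · subst h
    simp [colList]
  · have : (⟨k, by simpa [colList] using h₂⟩ : Fin n) ≠ j := fun he => h (he ▸ rfl)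
    simp [colList, this]

/-- A purchase adds two to the progress through the price and loses at most one through the offer; a
raise adds one. -/
theorem leads_bid_cur {l : List (Fin n)} {i : Fin n} {e : ℕ} {p : Fin n → ℕ}
    {o : Fin n → Option (Fin n)} (h : State.Inv A ⟨l, some i, e, p, o⟩) (f : List Sym) :
    ∃ s' : State n, s'.Inv A ∧ State.progress ⟨l, some i, e, p, o⟩ + 1 ≤ s'.progress ∧
      (scan.seq rewind).Leads ((none, .scan), State.store A ⟨l, some i, e + 1, p, o⟩ f)
        ((none, .scan), s'.store A f) := by
  by_cases hp : ∀ j, A i j = true → e < p j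
  · refine ⟨_, h.raise hp, by simp [State.progress], ?_⟩
    refine leads_scan_skip _ _ _ _ _ (by simp [rowBits, colList]) fun k hk hb => ?_
    simp only [Option.elim, rowBits, colList, List.getElem_ofFn] at hb ⊢
    exact hp _ hb
  -- The scan goes from left to right, so the column taken is the least affordable one.
  · have hex : ∃ k, ∃ hk : k < n, A i ⟨k, hk⟩ = true ∧ p ⟨k, hk⟩ ≤ e := by
      push Not at hp
      obtain ⟨j, hj, hj'⟩ := hp
      exact ⟨j, j.2, hj, hj'⟩
    classical
    obtain ⟨hk, hA, hle⟩ := Nat.find_spec hex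
    have hmin := fun m => Nat.find_min hex (m := m)
    generalize Nat.find hex = k at hk hA hle hmin
    refine ⟨_, h.take hA hle, ?_, ?_⟩
    · have hs : ∑ j', Function.update p ⟨k, hk⟩ (p ⟨k, hk⟩ + 1) j' = ∑ j', p j' + 1 := by
        rw [Finset.sum_update_of_mem (Finset.mem_univ _), ← Finset.add_sum_erase _ p
          (Finset.mem_univ (⟨k, hk⟩ : Fin n)), Finset.sdiff_singleton_eq_erase]
        ring
      simp only [State.progress, hs]
      lia
    · have := leads_scan_take (encodePending A l) f (colList A p o) (rowBits A i) (e + 1)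
        (by simp [rowBits, colList]) k (by simpa [colList] using hk)
        (by simpa [rowBits] using hA) (by simpa [colList] using Nat.lt_succ_of_le hle)
        (fun m hm hb => by
          have hmn : m < n := hm.trans hk
          have := hmin m hm
          simp only [rowBits, colList, List.getElem_ofFn] at hb ⊢
          by_contra! hcon
          exact this ⟨hmn, hb, by lia⟩)
      have hset := set_colList (A := A) p o i ⟨k, hk⟩
      simp only [colList, List.getElem_ofFn] at this hset
      rw [hset] at this
      exact this

theorem leads_bid {s : State n} (h : s.Inv A) (f : List Sym) :
    ∃ s' : State n, s'.Inv A ∧ (s'.Done ∨ ¬ s.Done ∧ s.progress + 1 ≤ s'.progress) ∧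
      bid.Leads ((some .tick, .scan),
          State.store A ⟨s.pending, s.cur, s.label + 1, s.price, s.owner⟩ f)
        ((none, .scan), s'.store A f) := by
  obtain ⟨l, _ | i, e, p, o⟩ := s
  · obtain _ | ⟨i, l⟩ := l
    -- A completed auction only accumulates ticks on the label, which no invariant constrains any
    -- more.
    · refine ⟨⟨[], none, e + 1, p, o⟩, ?_, .inl ⟨rfl, rfl⟩,
        (leads_loadRow_nil ..).seq (leads_scan_nil ..)⟩
      obtain ⟨h₁, h₂, h₃, h₄, h₅, h₆, h₇, h₈, h₉, h₁₀, h₁₁, h₁₂⟩ := h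
      exact ⟨by simp, by simp, h₃, h₄, h₅, h₆, h₇, h₈, h₉, h₁₀, h₁₁, h₁₂⟩
    · obtain ⟨s', h₁, h₂, h₃⟩ := leads_bid_cur h.load f
      exact ⟨s', h₁, .inr ⟨by simp [State.Done], h₂⟩,
        (leads_loadRow _ _ _ _ _ (isBit_head_encodePending l)).seq h₃⟩
  · obtain ⟨s', h₁, h₂, h₃⟩ := leads_bid_cur h f
    refine ⟨s', h₁, .inr ⟨by simp [State.Done], h₂⟩, Leads.seq ?_ h₃⟩
    obtain ⟨x, r, hx⟩ : ∃ x r, (rowBits A i).map Sym.bit = x :: r := by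
      rw [← List.ne_nil_iff_exists_cons]
      have := i.pos
      simp [rowBits]
      lia
    simp only [State.store, Option.elim, hx]
    exact leads_loadRow_of_row ..

theorem leads_auction {s : State n} (h : s.Inv A) (k : ℕ) (o : Option Sym) :
    ∃ s' : State n, s'.Inv A ∧ (s.Done → s'.Done) ∧ (s'.Done ∨ s.progress + k ≤ s'.progress) ∧
      auction.Leads ((o, .scan), s.store A (.replicate k .tick))
        ((none, .scan), s'.store A []) := by
  induction k generalizing s o with
  | zero => exact ⟨s, h, id, .inr le_rfl, Leads.loop_halt (by simp [State.store, setTop])⟩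
  | succ k ih =>
    obtain ⟨s₁, h₁, h₂, h₃⟩ := leads_bid h (.replicate k .tick)
    obtain ⟨s', h₁', hd, h₂', h₃'⟩ := ih h₁ none
    refine ⟨s', h₁', fun hs => hd (h₂.resolve_right fun h => h.1 hs), ?_,
      Leads.loop_goto (i := ()) (d := ((some .tick, .scan),
        State.store A ⟨s.pending, s.cur, s.label + 1, s.price, s.owner⟩ _)) ?_ h₃ h₃'⟩
    · rcases h₂ with h₂ | h₂
      · exact .inl (hd h₂)
      · exact h₂'.imp_right fun h => by lia
    · simp [State.store, setTop, List.replicate_succ]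

/-- A row that is bidding shows on its stack because the existence of `i : Fin n` makes its list of
bits nonempty. -/
theorem State.store_eq_nil (s : State n) (f : List Sym) :
    s.store A f .row = [] ∧ s.store A f .pending = [] ↔ s.Done := by
  obtain ⟨l, i, e, p, o⟩ := s
  refine and_congr ?_ ?_
  · cases i with
    | none => simp [State.store]
    | some i =>
      have := i.pos
      simp [State.store, rowBits]
      lia
  · cases l <;> simp [State.store, encodePending]

/-- The auction machine decides whether there is a perfect matching. -/
theorem leads_auction_init (A : Fin n → Fin n → Bool) {l : List (Fin n)} (hl : l.Nodup)
    (hl' : ∀ i, i ∈ l) {k : ℕ} (hk : 6 * n ^ 2 ≤ k) :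
    ∃ S : Store, (S .row = [] ∧ S .pending = [] ↔ HasPerm A) ∧
      auction.Leads ((none, .scan), regs (encodePending A l) [] [] [] []
        (.replicate n .mid) [] (.replicate k .tick)) ((none, .scan), S) := by
  obtain ⟨s, h₁, -, h₂, h₃⟩ := leads_auction (A := A) (State.inv_init hl hl') k none
  refine ⟨s.store A [], ?_, ?_⟩
  · rw [State.store_eq_nil]
    refine ⟨h₁.hasPerm, fun hA => ?_⟩
    by_contra hs
    have h₄ := h₁.progress_le hA hs
    have h₅ := h₂.resolve_left hs
    -- For `n = 0` the progress bounds do not conflict, but there are no rows to assign.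
    obtain rfl | hn := Nat.eq_zero_or_pos n
    · exact hs ⟨by rw [Option.eq_none_iff_forall_not_mem]; exact fun i => i.elim0,
        List.eq_nil_of_subset_nil fun i => i.elim0⟩
    -- The progress is at least `6 * n ^ 2`, yet at most `2 * n ^ 2 + 3 * n ≤ 5 * n ^ 2`.
    · have : n ≤ n ^ 2 := Nat.le_self_pow two_ne_zero n
      have : 0 < n ^ 2 := by positivity
      have : 2 * (n * (n + 1)) = 2 * n ^ 2 + 2 * n := by ring
      simp [State.progress, State.init] at h₅
      unfold State.progress at h₄
      lia
  · convert h₃ using 3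
    simp [State.store, State.init, colList, encodeCol, List.flatMap_def]

end Auction

/-! ### Invertible signings and permutations -/

/-- The product of the signs of the edges that a permutation uses. -/
def edgeSign {α : Type*} [Fintype α] (π : Equiv.Perm α) (s : Sym2 α → ℤˣ) : ℤˣ := ∏ i, s s(π i, i)

theorem edgeSign_mul {α : Type*} [Fintype α] (π : Equiv.Perm α) (s t : Sym2 α → ℤˣ) :
    edgeSign π (s * t) = edgeSign π s * edgeSign π t := Finset.prod_mul_distrib

section Sign

variable {α : Type*} [Fintype α] [DecidableEq α]

open Equiv Equiv.Perm

/-- The sign of a permutation is determined by its fixed points and the parities of the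
multiplicities with which it uses the undirected edges. -/
theorem Equiv.Perm.sign_eq_of_edge_parity {π π₀ : Perm α} (hfix : ∀ a, π a = a ↔ π₀ a = a)
    (hx : ∀ a b, a ≠ b → ((π a = b ↔ π b = a) ↔ (π₀ a = b ↔ π₀ b = a))) :
    sign π = sign π₀ := by
  -- An edge of a cycle of `π₀` of length at least three is used once by `π₀`, hence once by `π`:
  -- forwards or, as here, backwards.
  have h₁ : ∀ i, π₀ (π₀ i) ≠ i → π i ≠ π₀ i → π (π₀ i) = i := by
    intro i hi hne
    have hne' : i ≠ π₀ i := fun h => hi (by rw [← h, ← h])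
    have := hx i (π₀ i) hne'
    tauto
  have h₂ : ∀ i, π₀ (π₀ i) ≠ i → π i ≠ π₀ i → π₀ (π i) = i := by
    intro i hi hne
    by_contra hcon
    obtain ⟨b, rfl⟩ := π₀.surjective i
    have hne' : b ≠ π₀ b := fun h => hi (by rw [← h, ← h, ← h])
    have h₃ : π (π₀ b) ≠ b := fun h => hcon (by rw [h])
    have h₄ : π₀ (π₀ b) ≠ b := fun h => hi (by rw [h])
    have := hx b (π₀ b) hne'
    have h₅ : π b = π₀ b := by tauto
    have h₆ := h₁ _ hi hne
    rw [← h₅] at h₆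
    exact h₄ (by rw [← h₅]; exact π.injective h₆)
  -- If `i` lies in a 2-cycle of `π₀`, then `π₀` uses the edge from `i` to `π i` twice or not at
  -- all. So `π` uses it twice.
  have hW : ∀ i, π₀ i ≠ i → π₀ (π₀ i) = i → π (π i) = i := by
    intro i hi hi'
    have hne : i ≠ π i := fun h => hi ((hfix i).1 h.symm)
    have := hx i (π i) hne
    by_contra hcon
    have h₃ : π₀ i ≠ π i ∨ π₀ (π i) ≠ i := by tauto
    have h₄ : π₀ i = π i ∨ π₀ (π i) = i := by tauto
    rcases h₄ with h₄ | h₄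
    · rw [← h₄] at h₃; simp [hi'] at h₃
    · rw [π₀.injective (h₄.trans hi'.symm)] at h₃; simp [hi'] at h₃
  -- The points whose long `π₀`-cycle is traversed backwards by `π`.
  let Q : α → Prop := fun i => π₀ (π₀ i) ≠ i ∧ π i ≠ π₀ i
  have hQ : ∀ i, Q i → Q (π₀ i) := fun i hi =>
    ⟨fun h => hi.1 (π₀.injective h), by rw [h₁ i hi.1 hi.2]; exact hi.1.symm⟩
  let W : α → Prop := fun i => π₀ i ≠ i ∧ π₀ (π₀ i) = i
  have hW₀ : ∀ i, W i → W (π₀ i) := fun i hi =>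
    ⟨fun h => hi.1 (π₀.injective h), congrArg π₀ hi.2⟩
  have hWπ : ∀ i, W i → W (π i) := by
    intro i hi
    have h₃ := hW i hi.1 hi.2
    have h₄ : π i ≠ i := fun h => hi.1 ((hfix i).1 h)
    have h₅ : π₀ (π i) ≠ π i := fun h => h₄ (by have := (hfix _).2 h; rw [h₃] at this; exact this.symm)
    refine ⟨h₅, ?_⟩
    by_contra hcon
    by_cases h₆ : π (π i) = π₀ (π i)
    · have h₇ : π₀ (π i) = i := by rw [← h₆, h₃]
      have h₈ : π i = π₀ i := π₀.injective (h₇.trans hi.2.symm)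
      exact hcon (by rw [h₈, hi.2])
    · have h₇ := h₂ (π i) hcon h₆
      rw [h₃] at h₇
      exact hcon (by rw [← h₇, hi.2])
  classical
  -- The permutation `τ` is `π₀` on `Q`; `β` and `β₀` are `π` and `π₀` on the points of the
  -- 2-cycles. Both `β` and `β₀` are involutions with the same fixed points, hence of equal sign.
  let τ : Perm α := ofSubtype (subtypePermOfFintype π₀ hQ)
  let β : Perm α := ofSubtype (subtypePermOfFintype π hWπ)
  let β₀ : Perm α := ofSubtype (subtypePermOfFintype π₀ hW₀)
  have hτ : ∀ i, Q i → τ i = π₀ i := fun i hi => by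
    simp only [τ]; rw [ofSubtype_apply_of_mem _ hi]; rfl
  have hτ' : ∀ i, ¬ Q i → τ i = i := fun i hi => ofSubtype_apply_of_not_mem _ hi
  have hβ : ∀ i, W i → β i = π i := fun i hi => by
    simp only [β]; rw [ofSubtype_apply_of_mem _ hi]; rfl
  have hβ' : ∀ i, ¬ W i → β i = i := fun i hi => ofSubtype_apply_of_not_mem _ hi
  have hβ₀ : ∀ i, W i → β₀ i = π₀ i := fun i hi => by
    simp only [β₀]; rw [ofSubtype_apply_of_mem _ hi]; rfl
  have hβ₀' : ∀ i, ¬ W i → β₀ i = i := fun i hi => ofSubtype_apply_of_not_mem _ hi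
  have hββ : β ^ 2 = 1 := by
    ext i
    by_cases hi : W i
    · rw [pow_two, Perm.mul_apply, hβ i hi, hβ _ (hWπ i hi), hW i hi.1 hi.2, Perm.one_apply]
    · rw [pow_two, Perm.mul_apply, hβ' i hi, hβ' i hi, Perm.one_apply]
  have hββ₀ : β₀ ^ 2 = 1 := by
    ext i
    by_cases hi : W i
    · rw [pow_two, Perm.mul_apply, hβ₀ i hi, hβ₀ _ (hW₀ i hi), hi.2, Perm.one_apply]
    · rw [pow_two, Perm.mul_apply, hβ₀' i hi, hβ₀' i hi, Perm.one_apply]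
  have hfixed : Function.fixedPoints β = Function.fixedPoints β₀ := by
    ext i
    rw [Function.mem_fixedPoints_iff, Function.mem_fixedPoints_iff]
    by_cases hi : W i
    · rw [hβ i hi, hβ₀ i hi, hfix]
    · rw [hβ' i hi, hβ₀' i hi]
  have hsign : sign β = sign β₀ := by
    rw [sign_of_pow_two_eq_one hββ, sign_of_pow_two_eq_one hββ₀,
      Fintype.card_congr (Equiv.setCongr hfixed)]
  -- On `Q`, where `π` inverts `π₀`, multiplying by the square of `τ` restores the direction; a
  -- square does not affect the sign.
  have key : π * τ * τ = β * β₀ * π₀ := by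
    ext i
    simp only [Perm.mul_apply]
    by_cases hq : Q i
    · have hw : ¬ W (π₀ i) := fun h => hq.1 (π₀.injective h.2)
      rw [hτ i hq, hτ _ (hQ i hq), h₁ _ (hQ i hq).1 (hQ i hq).2, hβ₀' _ hw, hβ' _ hw]
    · rw [hτ' i hq, hτ' i hq]
      by_cases hw : W i
      · rw [hβ₀ _ (hW₀ i hw), hw.2, hβ i hw]
      · have hw' : ¬ W (π₀ i) := fun h => hw ⟨fun h' => h.1 (congrArg π₀ h'), π₀.injective h.2⟩
        rw [hβ₀' _ hw', hβ' _ hw']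
        by_cases hi : π₀ i = i
        · rw [hi, (hfix i).2 hi]
        · by_contra hne
          exact hq ⟨fun h => hw ⟨hi, h⟩, hne⟩
  have := congrArg sign key
  simp only [sign_mul, hsign, mul_assoc, Int.units_mul_self, mul_one] at this
  simpa [← mul_assoc] using this

theorem edgeSign_single_diag (π : Perm α) (a : α) :
    edgeSign π (Pi.mulSingle s(a, a) (-1)) = if π a = a then -1 else 1 := by
  rw [edgeSign, Finset.prod_eq_single a]
  · simp [Pi.mulSingle_apply]
  · intro i _ hi
    simp [hi]
  · simp

theorem edgeSign_single (π : Perm α) {a b : α} (hab : a ≠ b) :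
    edgeSign π (Pi.mulSingle s(a, b) (-1)) =
      (if π a = b then -1 else 1) * if π b = a then -1 else 1 := by
  rw [edgeSign, Finset.prod_eq_mul a b hab]
  · simp [Pi.mulSingle_apply, hab, hab.symm]
  · intro i _ hi
    simp [hi.1, hi.2]
  · simp
  · simp

/-- Signings that are negative on a single loop or edge detect fixed points and edge parities. -/
theorem sign_eq_of_edgeSign {π π₀ : Perm α} (h : ∀ s, edgeSign π s = edgeSign π₀ s) :
    sign π = sign π₀ := by
  refine sign_eq_of_edge_parity (fun a => ?_) fun a b hab => ?_
  · have := h (Pi.mulSingle s(a, a) (-1))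
    rw [edgeSign_single_diag, edgeSign_single_diag] at this
    by_cases h₁ : π a = a <;> by_cases h₂ : π₀ a = a <;> simp_all
  · have := h (Pi.mulSingle s(a, b) (-1))
    rw [edgeSign_single _ hab, edgeSign_single _ hab] at this
    by_cases h₁ : π a = b <;> by_cases h₂ : π₀ a = b <;> by_cases h₃ : π b = a <;>
      by_cases h₄ : π₀ b = a <;> simp_all

/-- The average of the product of two edge signs, as an unnormalized sum. -/
theorem sum_edgeSign (π π₀ : Perm α) :
    ∑ s, ((edgeSign π s * edgeSign π₀ s : ℤˣ) : ℤ) =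
      if ∀ s, edgeSign π s = edgeSign π₀ s then (Fintype.card (Sym2 α → ℤˣ) : ℤ) else 0 := by
  split_ifs with h
  · simp [h]
  · push Not at h
    obtain ⟨t, ht⟩ := h
    -- Translation by a `t` that separates the characters negates the sum, which is therefore zero.
    have ht' : edgeSign π t * edgeSign π₀ t = -1 := by
      rcases Int.units_eq_one_or (edgeSign π t) with h₁ | h₁ <;>
        rcases Int.units_eq_one_or (edgeSign π₀ t) with h₂ | h₂ <;> simp_all
    have : ∑ s, ((edgeSign π s * edgeSign π₀ s : ℤˣ) : ℤ) =
        -∑ s, ((edgeSign π s * edgeSign π₀ s : ℤˣ) : ℤ) := by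
      rw [← Finset.sum_neg_distrib, ← Equiv.sum_comp (Equiv.mulLeft t)]
      refine Finset.sum_congr rfl fun s _ => ?_
      rw [Equiv.coe_mulLeft, edgeSign_mul, edgeSign_mul, mul_mul_mul_comm, ht']
      simp
    lia

end Sign

/-- A nonnegative matrix with a permutation in its support has an invertible symmetric signing. -/
theorem exists_det_ne_zero {α : Type*} [Fintype α] [DecidableEq α] (N : Matrix α α ℝ)
    (hN : ∀ i j, 0 ≤ N i j) (π₀ : Equiv.Perm α) (hπ₀ : ∀ i, N (π₀ i) i ≠ 0) :
    ∃ s : Sym2 α → ℤˣ, (Matrix.of fun i j => N i j * ((s s(i, j) : ℤ) : ℝ)).det ≠ 0 := by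
  by_contra! hcon
  have hdet : ∀ s : Sym2 α → ℤˣ, ∑ π : Equiv.Perm α, ((Equiv.Perm.sign π : ℤ) : ℝ) *
      (∏ i, N (π i) i) * ((edgeSign π s : ℤ) : ℝ) = 0 := by
    intro s
    rw [← hcon s, Matrix.det_apply']
    refine Finset.sum_congr rfl fun π _ => ?_
    simp [Finset.prod_mul_distrib, edgeSign, mul_assoc]
  -- The determinants are averaged against `sign π₀ * edgeSign π₀ s`, and the sum over signings is
  -- moved inside.
  have hsum : ∑ π : Equiv.Perm α, (((Equiv.Perm.sign π₀ * Equiv.Perm.sign π : ℤˣ) : ℤ) : ℝ) *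
      (∏ i, N (π i) i) * ((∑ s, ((edgeSign π s * edgeSign π₀ s : ℤˣ) : ℤ) : ℤ) : ℝ) = 0 := by
    have : ∑ s : Sym2 α → ℤˣ, ((Equiv.Perm.sign π₀ : ℤ) : ℝ) * ((edgeSign π₀ s : ℤ) : ℝ) *
        ∑ π : Equiv.Perm α, ((Equiv.Perm.sign π : ℤ) : ℝ) *
        (∏ i, N (π i) i) * ((edgeSign π s : ℤ) : ℝ) = 0 := by
      simp [hdet]
    rw [← this]
    simp only [Finset.mul_sum, Int.cast_sum]
    rw [Finset.sum_comm]
    refine Finset.sum_congr rfl fun π _ => Finset.sum_congr rfl fun s _ => ?_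
    push_cast
    ring
  refine absurd hsum (ne_of_gt ?_)
  refine Finset.sum_pos' (fun π _ => ?_) ⟨π₀, Finset.mem_univ _, ?_⟩
  · rw [sum_edgeSign]
    split_ifs with h
    · rw [sign_eq_of_edgeSign h, Int.units_mul_self]
      have := Finset.prod_nonneg fun i (_ : i ∈ Finset.univ) => hN (π i) i
      simp only [Units.val_one, Int.cast_one, one_mul, Int.cast_natCast]
      positivity
    · simp
  · rw [sum_edgeSign, if_pos fun _ => rfl, Int.units_mul_self]
    have := Finset.prod_pos fun i (_ : i ∈ Finset.univ) =>
      lt_of_le_of_ne (hN (π₀ i) i) (hπ₀ i).symm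
    simp only [Units.val_one, Int.cast_one, one_mul, Int.cast_natCast]
    have : 0 < Fintype.card (Sym2 α → ℤˣ) := Fintype.card_pos
    positivity

/-- A symmetric matrix has an invertible symmetric signing if and only if there is a permutation in
its support. -/
theorem hasInvertibleSigning_iff {n : ℕ} {M : Matrix (Fin n) (Fin n) ℝ} (hM : M.IsSymm) :
    HasInvertibleSigning M ↔ ∃ π : Equiv.Perm (Fin n), ∀ i, M i (π i) ≠ 0 := by
  constructor
  · rintro ⟨s, -, -, hu⟩
    rw [Matrix.isUnit_iff_isUnit_det, isUnit_iff_ne_zero, Matrix.det_apply'] at hu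
    obtain ⟨π, -, hπ⟩ := Finset.exists_ne_zero_of_sum_ne_zero hu
    refine ⟨π, fun i hi => hπ ?_⟩
    rw [Finset.prod_eq_zero (Finset.mem_univ i), mul_zero]
    rw [signedMatrix, Matrix.hadamard_apply, hM.apply, hi, zero_mul]
  · rintro ⟨π, hπ⟩
    obtain ⟨s, hs⟩ := exists_det_ne_zero (Matrix.of fun i j => |M i j|) (fun _ _ => abs_nonneg _) π
      fun i => by simpa [hM.apply] using hπ i
    have hcast : ∀ u : ℤˣ, ((u : ℤ) : ℝ) = 1 ∨ ((u : ℤ) : ℝ) = -1 := fun u => by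
      rcases Int.units_eq_one_or u with rfl | rfl <;> simp
    -- The first factor cancels the signs of `M`, so that the signed matrix is `|M|` signed by `s`;
    -- it is symmetric because `M` is.
    refine ⟨Matrix.of fun i j => (if M i j < 0 then -1 else 1) * ((s s(i, j) : ℤ) : ℝ),
      fun i j => ?_, ?_, ?_⟩
    · rcases hcast (s s(i, j)) with h | h <;> rw [Matrix.of_apply, h] <;> split_ifs <;> simp
    · ext i j
      simp [hM.apply i j, Sym2.eq_swap (a := j)]
    · rw [Matrix.isUnit_iff_isUnit_det, isUnit_iff_ne_zero]
      convert hs using 2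
      ext i j
      simp only [signedMatrix, Matrix.hadamard_apply, Matrix.of_apply]
      split_ifs with h
      · rw [abs_of_neg h]; ring
      · rw [abs_of_nonneg (not_lt.1 h)]; ring

/-! ### Routines as deciders -/

theorem initList_stk (tm : FinTM2) (s : List (tm.Γ tm.k₀)) :
    (initList tm s).stk = Function.update (fun _ => []) tm.k₀ s := by
  funext k
  by_cases h : k = tm.k₀
  · subst h; simp [initList]
  · simp [initList, h]

theorem haltList_stk (tm : FinTM2) (s : List (tm.Γ tm.k₁)) :
    (haltList tm s).stk = Function.update (fun _ => []) tm.k₁ s := by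
  funext k
  by_cases h : k = tm.k₁
  · subst h; simp [haltList]
  · simp [haltList, h]

/-- A question is decided in polynomial time if a routine answers it in polynomial time. -/
theorem PolyTimeDecidable.of_routine {α Γ₀ : Type} {enc : α → List Γ₀} {P : α → Prop} {K σ : Type}
    [DecidableEq K] [Fintype K] [Fintype σ] {Γ : K → Type} (M : Routine Γ σ) (v₀ : σ) (k₀ k₁ : K)
    [Fintype (Γ k₀)] (e₀ : Γ k₀ ≃ Γ₀) (e₁ : Γ k₁ ≃ Bool) (p : Polynomial ℕ)
    (h : ∀ a, ∃ b : Bool, (b = true ↔ P a) ∧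
      M.Runs (v₀, Function.update (fun _ => []) k₀ ((enc a).map e₀.symm))
        (v₀, Function.update (fun _ => []) k₁ [e₁.symm b]) (p.eval (enc a).length)) :
    PolyTimeDecidable enc P := by
  classical
  refine ⟨⟨⟨⟨k₀, k₁, Γ, M.Λ, M.main, σ, v₀, M.code⟩, e₀, e₁⟩, p, fun a => ?_⟩⟩
  have h' := (h a).imp fun b hb => hb.2.imp fun s hs => (⟨hb.1, hs⟩ : (b = true ↔ P a) ∧ _)
  choose b s hb hs hrun using h'
  refine ⟨⟨s, ?_⟩, hs⟩
  have hb' : decide (P a) = b := by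
    cases b <;> simp_all
  have h₁ := hrun.iterate_eq
  simp only at h₁
  have h₂ := initList_stk ⟨k₀, k₁, Γ, M.Λ, M.main, σ, v₀, M.code⟩ ((enc a).map e₀.symm)
  have h₃ := haltList_stk ⟨k₀, k₁, Γ, M.Λ, M.main, σ, v₀, M.code⟩ [e₁.symm b]
  dsimp only at h₂ h₃
  rw [← h₂, ← h₃] at h₁
  refine h₁.trans ?_
  have h₄ : Computability.encodeBool (decide (P a)) = [b] := by rw [hb']; rfl
  rw [h₄]
  rfl

/-- The program of a Turing machine as a routine. -/
def Turing.FinTM2.routine (tm : FinTM2) : Routine tm.Γ tm.σ where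
  Λ := tm.Λ
  fin := tm.ΛFin
  main := tm.main
  code := tm.m

theorem Turing.TM2OutputsInTime.runs {tm : FinTM2} {s : List (tm.Γ tm.k₀)}
    {s' : List (tm.Γ tm.k₁)} {t : ℕ} (h : TM2OutputsInTime tm s (some s') t) :
    tm.routine.Runs (tm.initialState, Function.update (fun _ => []) tm.k₀ s)
      (tm.initialState, Function.update (fun _ => []) tm.k₁ s') t := by
  refine ⟨h.steps, h.steps_le_m, ?_⟩
  rw [← initList_stk, ← haltList_stk]
  exact Steps.of_iterate_eq h.evals_in_steps

/-! ### The machine for InvertibleSigning -/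

namespace SigningMachine

open Routine Auction

/-- The stacks that are used to read the input and to write the output. -/
inductive Aux
  | inp | word | out
  deriving DecidableEq

instance : Fintype Aux where
  elems := {.inp, .word, .out}
  complete k := by cases k <;> decide

variable (tm : FinTM2) (G : Type)

/-- The names of the stacks: those of the machine `tm`, those for input and output, and those of the
auction machine. -/
abbrev Stk : Type := tm.K ⊕ (Aux ⊕ Reg)

/-- The alphabets of the stacks. -/
abbrev Alph : Stk tm → Type
  | .inl k => tm.Γ k
  | .inr (.inl .inp) => G ⊕ Bool
  | .inr (.inl .word) => G ⊕ Bool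
  | .inr (.inl .out) => Bool
  | .inr (.inr _) => Sym

/-- The internal memory: that of the machine `tm`, the input symbol read last, and that of the
auction machine. -/
abbrev Var : Type := tm.σ × (Option (G ⊕ Bool) × Ctl)

/-- Statements of the machine. -/
abbrev SStmt (ι : Type) : Type := TM2.Stmt (Alph tm G) ι (Var tm G)

/-- Routines of the machine. -/
abbrev SRoutine : Type 1 := Routine (Alph tm G) (Var tm G)

/-- The name of a stack for input or output. -/
abbrev aux (k : Aux) : Stk tm := .inr (.inl k)

/-- The name of a stack of the auction machine. -/
abbrev reg (k : Reg) : Stk tm := .inr (.inr k)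

variable {tm G}

/-- Store the input symbol that was read. -/
def setSym (v : Var tm G) (o : Option (G ⊕ Bool)) : Var tm G := (v.1, o, v.2.2)

/-- The input symbol read last. -/
def sym (v : Var tm G) : G ⊕ Bool := v.2.1.getD (.inr false)

/-- Store the symbol that was read from a stack of the auction machine. -/
def setAuctionTop (v : Var tm G) (o : Option Sym) : Var tm G := (v.1, v.2.1, setTop v.2.2 o)

variable (tm G) in
/-- The memory in the idle state. -/
def idle : Var tm G := (tm.initialState, none, none, .scan)

open Classical in
/-- Move a numeral to the input stack of `tm`. -/
noncomputable def feed (eq : tm.Γ tm.k₀ ≃ G) : SRoutine tm G :=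
  if h : Nonempty G then
    loop (ι := Unit) (.pop (aux tm .word) setSym <| .branch (fun v => v.2.1.isSome)
      (.push (.inl tm.k₀) (fun v => eq.symm ((sym v).elim id fun _ => h.some)) <|
        .goto fun _ => ()) .halt) fun _ => skip
  else skip

/-- Run `tm`. -/
def test : SRoutine tm G :=
  Routine.lift (Γ := Alph tm G) Sum.inl Prod.fst (fun a v => (a, v.2)) tm.routine

/-- Read the output of `tm` and record the answer. -/
def record (eq : tm.Γ tm.k₁ ≃ Bool) : SRoutine tm G :=
  op (.pop (.inl tm.k₁) (fun v o => setSym v (o.map fun b => .inr (eq b))) <|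
    .push (reg tm .pending) (fun v => .bit ((sym v).elim (fun _ => false) not)) <|
    .push (reg tm .fuel) (fun _ => .tick) <| .push (reg tm .fuel) (fun _ => .tick) <|
    .push (reg tm .fuel) (fun _ => .tick) <| .push (reg tm .fuel) (fun _ => .tick) <|
    .push (reg tm .fuel) (fun _ => .tick) <| .push (reg tm .fuel) (fun _ => .tick) <|
    .load (fun v => setSym v none) .halt)

/-- Whether a symbol of a numeral was read. -/
def isDigit : Option (G ⊕ Bool) → Bool
  | some (.inl _) => true
  | _ => false

/-- Whether an end-of-row mark was read. -/
def isRowEnd : Option (G ⊕ Bool) → Bool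
  | some (.inr true) => true
  | _ => false

/-- Process the next symbol of the input. -/
def readStmt : SStmt tm G Bool :=
  .pop (aux tm .inp) setSym <| .branch (fun v => v.2.1.isNone) .halt <|
  .branch (fun v => isDigit v.2.1) (.push (aux tm .word) sym <| .goto fun _ => false) <|
  .branch (fun v => isRowEnd v.2.1) (.push (reg tm .pending) (fun _ => .mid) <|
    .push (reg tm .cols) (fun _ => .mid) <| .goto fun _ => false) <|
  .goto fun _ => true

/-- Read the input. -/
noncomputable def read (eq₀ : tm.Γ tm.k₀ ≃ G) (eq₁ : tm.Γ tm.k₁ ≃ Bool) : SRoutine tm G :=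
  loop readStmt fun b => if b then (feed eq₀).seq (test.seq (record eq₁)) else skip

/-- Run a routine of the auction machine. -/
def onRegs (A : ARoutine) : SRoutine tm G :=
  Routine.lift (Γ := Alph tm G) (fun k => reg tm k) (fun v => v.2.2)
    (fun c v => (v.1, v.2.1, c)) A

/-- Write the answer. -/
def verdict : SRoutine tm G :=
  op (.peek (reg tm .row) setAuctionTop <| .branch (fun v => v.2.2.1.isSome)
    (.push (aux tm .out) (fun _ => false) <| .load (fun v => setAuctionTop v none) .halt) <|
    .peek (reg tm .pending) setAuctionTop <|
    .push (aux tm .out) (fun v => v.2.2.1.isNone) <| .load (fun v => setAuctionTop v none) .halt)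

/-- The whole machine. -/
noncomputable def machine (eq₀ : tm.Γ tm.k₀ ≃ G) (eq₁ : tm.Γ tm.k₁ ≃ Bool) : SRoutine tm G :=
  (read eq₀ eq₁).seq ((onRegs auction).seq (verdict.seq (onRegs drainAll)))

/-! #### The contents of the stacks -/

/-- The stacks with the given contents. -/
def tapes (T : ∀ k, List (tm.Γ k)) (i w : List (G ⊕ Bool)) (o : List Bool) (R : Store) :
    ∀ k, List (Alph tm G k)
  | .inl k => T k
  | .inr (.inl .inp) => i
  | .inr (.inl .word) => w
  | .inr (.inl .out) => o
  | .inr (.inr k) => R k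

section

variable (T : ∀ k, List (tm.Γ k)) (i w : List (G ⊕ Bool)) (o : List Bool) (R : Store)

@[simp] theorem tapes_inl (k : tm.K) : tapes T i w o R (.inl k) = T k := rfl
@[simp] theorem tapes_inp : tapes T i w o R (.inr (.inl .inp)) = i := rfl
@[simp] theorem tapes_word : tapes T i w o R (.inr (.inl .word)) = w := rfl
@[simp] theorem tapes_out : tapes T i w o R (.inr (.inl .out)) = o := rfl
@[simp] theorem tapes_reg (k : Reg) : tapes T i w o R (.inr (.inr k)) = R k := rfl

@[simp] theorem update_tapes_inl (k : tm.K) (x : List (tm.Γ k)) :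
    Function.update (tapes T i w o R) (.inl k) x = tapes (Function.update T k x) i w o R := by
  funext l
  rcases l with l | (_ | _ | _) | l
  · rcases eq_or_ne l k with rfl | h
    · simp
    · simp [h]
  all_goals simp
@[simp] theorem update_tapes_inp (x : List (G ⊕ Bool)) :
    Function.update (tapes T i w o R) (.inr (.inl .inp)) x = tapes T x w o R := by
  funext l
  rcases l with l | (_ | _ | _) | l <;> simp
@[simp] theorem update_tapes_word (x : List (G ⊕ Bool)) :
    Function.update (tapes T i w o R) (.inr (.inl .word)) x = tapes T i x o R := by
  funext l
  rcases l with l | (_ | _ | _) | l <;> simp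
@[simp] theorem update_tapes_out (x : List Bool) :
    Function.update (tapes T i w o R) (.inr (.inl .out)) x = tapes T i w x R := by
  funext l
  rcases l with l | (_ | _ | _) | l <;> simp
@[simp] theorem update_tapes_reg (k : Reg) (x : List Sym) :
    Function.update (tapes T i w o R) (.inr (.inr k)) x =
      tapes T i w o (Function.update R k x) := by
  funext l
  rcases l with l | (_ | _ | _) | l
  on_goal 5 =>
    rcases eq_or_ne l k with rfl | h
    · simp
    · simp [h]
  all_goals simp

end

/-! #### Reading the input -/

theorem runs_feed (eq : tm.Γ tm.k₀ ≃ G) (l : List G) (T : List (tm.Γ tm.k₀))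
    (i : List (G ⊕ Bool)) (R : Store) (o : Option (G ⊕ Bool)) :
    ∃ o', (feed eq).Runs ((tm.initialState, o, none, .scan),
        tapes (Function.update (fun _ => []) tm.k₀ T) i (l.map .inl) [] R)
      ((tm.initialState, o', none, .scan), tapes (Function.update (fun _ => []) tm.k₀
        (l.reverse.map eq.symm ++ T)) i [] [] R) (2 * l.length + 1) := by
  by_cases h : Nonempty G
  · rw [feed, dif_pos h]
    refine ⟨none, ?_⟩
    induction l generalizing T o with
    | nil => exact Runs.loop_halt (by simp [setSym])
    | cons g l ih =>
      have h₁ := ih (eq.symm g :: T) (some (.inl g))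
      have h₂ := Runs.loop_goto (i := ()) (t := 1) (d := ((tm.initialState, some (.inl g), none,
        Mode.scan), tapes (Function.update (fun _ => []) tm.k₀ (eq.symm g :: T)) i (l.map .inl) [] R))
        (c := ((tm.initialState, o, none, Mode.scan),
          tapes (Function.update (fun _ => []) tm.k₀ T) i ((g :: l).map .inl) [] R))
        (by simp [setSym, sym]) Runs.skip h₁
      simpa using h₂.mono (t' := 2 * (l.length + 1) + 1) (by lia)
  · rw [feed, dif_neg h]
    obtain rfl : l = [] := by
      cases l with
      | nil => rfl
      | cons g l => exact absurd ⟨g⟩ h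
    exact ⟨o, by simpa using Runs.skip⟩

/-- A machine that outputs a word halts in its initial internal state with all other stacks empty;
once its answer is popped it is ready for the next entry. -/
theorem runs_test {s : List (tm.Γ tm.k₀)} {s' : List (tm.Γ tm.k₁)} {t : ℕ}
    (h : TM2OutputsInTime tm s (some s') t) (i : List (G ⊕ Bool)) (R : Store)
    (o : Option (G ⊕ Bool)) :
    (test : SRoutine tm G).Runs ((tm.initialState, o, none, Mode.scan),
        tapes (Function.update (fun _ => []) tm.k₀ s) i [] [] R)
      ((tm.initialState, o, none, Mode.scan),
        tapes (Function.update (fun _ => []) tm.k₁ s') i [] [] R) t := by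
  obtain ⟨S', h₁, h₂, h₃⟩ := Runs.lift (Γ := Alph tm G) (e := Sum.inl) (get := Prod.fst)
    (put := fun a v => (a, v.2)) Sum.inl_injective (fun _ _ => rfl) (fun _ _ _ => rfl)
    (tm.initialState, o, none, Mode.scan)
    (S := tapes (Function.update (fun _ => []) tm.k₀ s) i [] [] R) h.runs
  have hS : S' = tapes (Function.update (fun _ => []) tm.k₁ s') i [] [] R := by
    funext k
    rcases k with k | k
    · exact h₂ k
    · rw [h₃ _ (by simp)]
      rcases k with (_ | _ | _) | k <;> rfl
  rw [hS] at h₁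
  exact h₁

/-- The answer is negated, since `tm` reports zeros while the auction needs the support. Six ticks
per entry give the fuel `6 * n ^ 2`. -/
theorem runs_record (eq : tm.Γ tm.k₁ ≃ Bool) (b : Bool) (i : List (G ⊕ Bool))
    (p c f : List Sym) (o : Option (G ⊕ Bool)) :
    (record eq).Runs ((tm.initialState, o, none, .scan),
        tapes (Function.update (fun _ => []) tm.k₁ [eq.symm b]) i [] []
          (regs p [] [] [] [] c [] f))
      (idle tm G, tapes (fun _ => []) i [] []
        (regs (.bit (!b) :: p) [] [] [] [] c [] (.replicate 6 .tick ++ f))) 1 := by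
  refine Runs.op ?_
  simp [setSym, sym, idle, List.replicate]

end SigningMachine

/-! ### The time for reading the matrix -/

namespace SigningMachine

open Routine Auction

variable {tm : FinTM2} {G : Type} {eq₀ : tm.Γ tm.k₀ ≃ G} {eq₁ : tm.Γ tm.k₁ ≃ Bool}
  {c' : Memory (Alph tm G) (Var tm G)} {t : ℕ}

theorem runs_read_digits (l : List G) (w i : List (G ⊕ Bool)) (R : Store)
    (h : ∀ o, (read eq₀ eq₁).Runs ((tm.initialState, o, none, Mode.scan),
      tapes (fun _ => []) i (l.reverse.map .inl ++ w) [] R) c' t) (o : Option (G ⊕ Bool)) :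
    (read eq₀ eq₁).Runs ((tm.initialState, o, none, Mode.scan),
      tapes (fun _ => []) (l.map .inl ++ i) w [] R) c' (t + 2 * l.length) := by
  induction l generalizing w o with
  | nil => simpa using h o
  | cons g l ih =>
    have h₁ := ih (.inl g :: w) (by simpa using h) (some (.inl g))
    have h₂ := Runs.loop_goto (i := false) (t := 1) (d := ((tm.initialState, some (.inl g), none,
        Mode.scan), tapes (fun _ => []) (l.map .inl ++ i) (.inl g :: w) [] R))
      (c := ((tm.initialState, o, none, Mode.scan),
        tapes (fun _ => []) ((g :: l).map .inl ++ i) w [] R))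
      (by simp [readStmt, setSym, sym, isDigit]) Runs.skip h₁
    refine h₂.mono ?_
    rw [List.length_cons]
    lia

/-- The digits are reversed twice, on the way to `word` and from there to the input stack of `tm`,
so `tm` sees them in their original order. -/
theorem runs_read_entry {l : List G} {b : Bool} {s : ℕ}
    (hl : TM2OutputsInTime tm (l.map eq₀.symm) (some [eq₁.symm b]) s) (i : List (G ⊕ Bool))
    (p c f : List Sym)
    (h : ∀ o, (read eq₀ eq₁).Runs ((tm.initialState, o, none, Mode.scan), tapes (fun _ => []) i [] []
      (regs (.bit (!b) :: p) [] [] [] [] c [] (.replicate 6 .tick ++ f))) c' t)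
    (o : Option (G ⊕ Bool)) :
    (read eq₀ eq₁).Runs ((tm.initialState, o, none, Mode.scan),
      tapes (fun _ => []) (l.map .inl ++ .inr false :: i) [] [] (regs p [] [] [] [] c [] f)) c'
      (t + 4 * l.length + s + 3) := by
  refine (runs_read_digits l [] _ _ (t := t + 2 * l.length + s + 3) (fun o => ?_) o).mono (by lia)
  obtain ⟨o', h₁⟩ := runs_feed eq₀ l.reverse [] i (regs p [] [] [] [] c [] f) (some (.inr false))
  rw [List.reverse_reverse, List.append_nil, Function.update_eq_self_iff.2 rfl] at h₁
  have h₂ := h₁.seq ((runs_test hl i (regs p [] [] [] [] c [] f) o').seq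
    (runs_record eq₁ b i p c f o'))
  have h₃ := Runs.loop_goto (q := readStmt) (i := true)
    (B := fun b => if b then (feed eq₀).seq (test.seq (record eq₁)) else skip)
    (c := ((tm.initialState, o, none, Mode.scan), tapes (fun _ => []) (.inr false :: i)
      (l.reverse.map .inl ++ []) [] (regs p [] [] [] [] c [] f)))
    (by simp [readStmt, setSym, isDigit, isRowEnd]) h₂ (h none)
  refine h₃.mono ?_
  rw [List.length_reverse]
  lia

/-- One separator completes the waiting row; the other is the code of a free column of price zero,
so a matrix with `n` rows gets `n` columns. -/
theorem runs_read_rowEnd (i : List (G ⊕ Bool)) (p c f : List Sym)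
    (h : ∀ o, (read eq₀ eq₁).Runs ((tm.initialState, o, none, Mode.scan), tapes (fun _ => []) i [] []
      (regs (.mid :: p) [] [] [] [] (.mid :: c) [] f)) c' t) (o : Option (G ⊕ Bool)) :
    (read eq₀ eq₁).Runs ((tm.initialState, o, none, Mode.scan),
      tapes (fun _ => []) (.inr true :: i) [] [] (regs p [] [] [] [] c [] f)) c' (t + 2) := by
  have h₂ := Runs.loop_goto (q := readStmt) (i := false) (t := 1)
    (B := fun b => if b then (feed eq₀).seq (test.seq (record eq₁)) else skip)
    (c := ((tm.initialState, o, none, Mode.scan), tapes (fun _ => []) (.inr true :: i) []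
      [] (regs p [] [] [] [] c [] f))) (d := ((tm.initialState, some (.inr true), none, Mode.scan),
        tapes (fun _ => []) i [] [] (regs (.mid :: p) [] [] [] [] (.mid :: c) [] f)))
    (by simp [readStmt, setSym, isDigit, isRowEnd]) Runs.skip (h _)
  exact h₂.mono (by lia)

theorem runs_read_nil (R : Store) (o : Option (G ⊕ Bool)) :
    (read eq₀ eq₁).Runs ((tm.initialState, o, none, Mode.scan), tapes (fun _ => []) [] [] [] R)
      (idle tm G, tapes (fun _ => []) [] [] [] R) 1 :=
  Runs.loop_halt (by simp [readStmt, setSym, idle])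

variable {D : Type} {code : D → List G} {z : D → Bool} {q : Polynomial ℕ} {N : ℕ}

theorem runs_read_row
    (hq : ∀ d, TM2OutputsInTime tm ((code d).map eq₀.symm) (some [eq₁.symm (z d)])
      (q.eval (code d).length))
    (l : List D) (hl : ∀ d ∈ l, (code d).length ≤ N)
    (i : List (G ⊕ Bool)) (p c f : List Sym)
    (h : ∀ o, (read eq₀ eq₁).Runs ((tm.initialState, o, none, Mode.scan), tapes (fun _ => []) i [] []
      (regs (.mid :: (l.reverse.map fun d => .bit (!z d)) ++ p) [] [] [] [] (.mid :: c) []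
        (.replicate (6 * l.length) .tick ++ f))) c' t)
    (o : Option (G ⊕ Bool)) :
    (read eq₀ eq₁).Runs ((tm.initialState, o, none, Mode.scan),
      tapes (fun _ => []) ((l.flatMap fun d => (code d).map .inl ++ [.inr false]) ++ .inr true :: i)
        [] [] (regs p [] [] [] [] c [] f)) c'
      (t + ((l.flatMap fun d => (code d).map .inl ++ [(.inr false : G ⊕ Bool)]).length + 1) *
        (q.eval N + 4)) := by
  induction l generalizing p f o with
  | nil =>
    refine (runs_read_rowEnd i p c f (by simpa using h) o).mono ?_
    simp
  | cons d l ih =>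
    have h₁ := ih (fun d hd => hl d (by simp [hd])) (.bit (!z d) :: p) (.replicate 6 .tick ++ f)
      (by
        rw [← List.append_assoc, List.replicate_append_replicate]
        simpa [mul_add] using h)
    have h₂ := runs_read_entry (hq d) _ p c f h₁ o
    rw [List.flatMap_cons, List.append_assoc, List.append_assoc, List.singleton_append]
    refine h₂.mono ?_
    have h₃ := eval_mono q (hl d (by simp))
    simp only [List.length_append, List.length_map, List.length_singleton]
    -- An entry with `L` digits occupies `L + 1` symbols and costs at most `4 * L + q.eval N + 3`.
    nlinarith [Nat.zero_le ((code d).length * q.eval N)]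

theorem runs_read_rows
    (hq : ∀ d, TM2OutputsInTime tm ((code d).map eq₀.symm) (some [eq₁.symm (z d)])
      (q.eval (code d).length))
    (ls : List (List D)) (hl : ∀ l ∈ ls, ∀ d ∈ l, (code d).length ≤ N)
    (p c f : List Sym) (o : Option (G ⊕ Bool)) :
    (read eq₀ eq₁).Runs ((tm.initialState, o, none, Mode.scan),
      tapes (fun _ => []) (ls.flatMap fun l =>
        (l.flatMap fun d => (code d).map .inl ++ [.inr false]) ++ [.inr true])
        [] [] (regs p [] [] [] [] c [] f))
      (idle tm G, tapes (fun _ => []) [] [] []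
        (regs ((ls.reverse.flatMap fun l => .mid :: l.reverse.map fun d => .bit (!z d)) ++ p)
          [] [] [] [] (.replicate ls.length .mid ++ c) []
          (.replicate (6 * (ls.map List.length).sum) .tick ++ f)))
      ((ls.flatMap fun l => (l.flatMap fun d => (code d).map .inl ++ [(.inr false : G ⊕ Bool)]) ++
        [.inr true]).length * (q.eval N + 4) + 1) := by
  induction ls generalizing p c f o with
  | nil => simpa using runs_read_nil _ o
  | cons l ls ih =>
    rw [List.flatMap_cons, List.append_assoc, List.singleton_append]
    have e₁ : ((l :: ls).reverse.flatMap fun l => Sym.mid :: l.reverse.map fun d => .bit (!z d)) ++ p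
        = (ls.reverse.flatMap fun l => .mid :: l.reverse.map fun d => .bit (!z d)) ++
          (.mid :: (l.reverse.map fun d => .bit (!z d)) ++ p) := by
      simp
    have e₂ : List.replicate (l :: ls).length Sym.mid ++ c =
        List.replicate ls.length .mid ++ .mid :: c := by
      rw [List.length_cons, List.replicate_succ']
      simp
    have e₃ : List.replicate (6 * ((l :: ls).map List.length).sum) Sym.tick ++ f =
        List.replicate (6 * (ls.map List.length).sum) .tick ++
          (List.replicate (6 * l.length) .tick ++ f) := by
      rw [← List.append_assoc, List.replicate_append_replicate, ← mul_add, List.map_cons,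
        List.sum_cons, add_comm l.length]
    rw [e₁, e₂, e₃]
    refine (runs_read_row hq l (hl l (by simp)) _ p c f
      (fun o => ih (fun l hl' => hl l (by simp [hl'])) _ _ _ o) o).mono ?_
    rw [List.length_append, List.length_cons]
    exact le_of_eq (by ring)

end SigningMachine

/-! ### The whole machine and its running time -/

namespace SigningMachine

open Routine Auction

variable {tm : FinTM2} {G : Type} {eq₀ : tm.Γ tm.k₀ ≃ G} {eq₁ : tm.Γ tm.k₁ ≃ Bool}

theorem runs_onRegs {A : ARoutine} {m m' : Ctl} {R R' : Store} {t : ℕ}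
    (h : A.Runs (m, R) (m', R') t) (s : tm.σ) (x : Option (G ⊕ Bool)) (T : ∀ k, List (tm.Γ k))
    (i w : List (G ⊕ Bool)) (o : List Bool) :
    (onRegs A : SRoutine tm G).Runs ((s, x, m), tapes T i w o R) ((s, x, m'), tapes T i w o R')
      t := by
  obtain ⟨S', h₁, h₂, h₃⟩ := Runs.lift (Γ := Alph tm G) (e := fun k => reg tm k)
    (get := fun v => v.2.2) (put := fun c v => (v.1, v.2.1, c))
    (Sum.inr_injective.comp Sum.inr_injective) (fun _ _ => rfl) (fun _ _ _ => rfl) (s, x, m)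
    (S := tapes T i w o R) h
  have hS : S' = tapes T i w o R' := by
    funext k
    rcases k with k | (_ | _ | _) | k
    on_goal 5 => exact h₂ k
    all_goals rw [h₃ _ (by simp)]; rfl
  rw [hS] at h₁
  exact h₁

theorem runs_verdict (R : Store) :
    (verdict : SRoutine tm G).Runs (idle tm G, tapes (fun _ => []) [] [] [] R)
      (idle tm G, tapes (fun _ => []) [] [] [decide (R .row = [] ∧ R .pending = [])] R) 1 := by
  refine Runs.op ?_
  rcases h : R .row with _ | ⟨a, l⟩ <;> rcases h' : R .pending with _ | ⟨a', l'⟩ <;>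
    simp [h, h', setAuctionTop, setTop, idle]

variable {D : Type} {code : D → List G} {val : D → ℝ}

theorem encode_eq (A : SymMatrixInput val) : A.encode code =
    (List.ofFn fun i => List.ofFn fun j => A.entries i j).flatMap fun l =>
      (l.flatMap fun d => (code d).map .inl ++ [.inr false]) ++ [.inr true] := by
  simp only [SymMatrixInput.encode, List.flatMap, List.map_ofFn, Function.comp_def]

theorem length_encode (A : SymMatrixInput val) : (A.encode code).length =
    ∑ i, (∑ j, ((code (A.entries i j)).length + 1) + 1) := by
  simp [SymMatrixInput.encode, List.length_flatten, List.map_ofFn, List.sum_ofFn, Function.comp_def]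

theorem length_code_le (A : SymMatrixInput val) (i j : Fin A.n) :
    (code (A.entries i j)).length ≤ (A.encode code).length := by
  rw [length_encode]
  have h₁ : _ ≤ _ := Finset.single_le_sum
    (f := fun i => ∑ j, ((code (A.entries i j)).length + 1) + 1)
    (fun _ _ => Nat.zero_le _) (Finset.mem_univ i)
  have h₂ : _ ≤ _ := Finset.single_le_sum (f := fun j => (code (A.entries i j)).length + 1)
    (fun _ _ => Nat.zero_le _) (Finset.mem_univ j)
  exact ((Nat.le_succ _).trans h₂).trans ((Nat.le_succ _).trans h₁)

theorem le_length_encode (A : SymMatrixInput val) :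
    A.n * (A.n + 1) ≤ (A.encode code).length := by
  rw [length_encode]
  simp only [Finset.sum_add_distrib]
  simp
  lia

theorem runs_machine {z : D → Bool} {q : Polynomial ℕ}
    (hq : ∀ d, TM2OutputsInTime tm ((code d).map eq₀.symm) (some [eq₁.symm (z d)])
      (q.eval (code d).length)) :
    ∃ p : Polynomial ℕ, ∀ A : SymMatrixInput val, ∃ b : Bool,
      (b = true ↔ HasPerm fun i j => !z (A.entries i j)) ∧
      (machine eq₀ eq₁).Runs (idle tm G, tapes (fun _ => []) (A.encode code) [] [] fun _ => [])
        (idle tm G, tapes (fun _ => []) [] [] [b] fun _ => []) (p.eval (A.encode code).length) := by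
  obtain ⟨p₁, hp₁⟩ := bounded_auction.runs
  obtain ⟨p₂, hp₂⟩ := bounded_drainAll.runs
  -- The summands pay for reading, the auction, the verdict and the final emptying of the stacks,
  -- which the convention for halting requires.
  refine ⟨.X * (q + 4) + 1 + (p₁.comp (8 * .X) + (1 + p₂.comp (8 * .X))), fun A => ?_⟩
  set N := (A.encode code).length with hN
  have h₁ := runs_read_rows (N := N) hq (List.ofFn fun i => List.ofFn fun j => A.entries i j)
    (by
      intro l hl d hd
      obtain ⟨i, rfl⟩ := (List.mem_ofFn' _ _).1 hl
      obtain ⟨j, rfl⟩ := (List.mem_ofFn' _ _).1 hd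
      exact length_code_le A i j) [] [] [] none
  rw [← encode_eq, ← hN] at h₁
  have e₁ : ((List.ofFn fun i => List.ofFn fun j => A.entries i j).reverse.flatMap fun l =>
      Sym.mid :: l.reverse.map fun d => .bit (!z d)) ++ [] =
      encodePending (fun i j => !z (A.entries i j)) (List.finRange A.n).reverse := by
    rw [List.append_nil, encodePending, List.ofFn_eq_map,
      ← List.map_reverse, List.flatMap_map]
    simp [rowBits, List.map_ofFn, Function.comp_def]
  have e₂ : ((List.ofFn fun i => List.ofFn fun j => A.entries i j).map List.length).sum = A.n ^ 2 := by
    simp [List.map_ofFn, Function.comp_def, sq]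
  rw [e₁, e₂, List.length_ofFn, List.append_nil, List.append_nil] at h₁
  obtain ⟨S, hS, h₂⟩ := leads_auction_init (k := 6 * A.n ^ 2) (fun i j => !z (A.entries i j))
    (List.nodup_reverse.2 (List.nodup_finRange A.n)) (fun i => by simp) le_rfl
  -- The stacks hold `7 * n ^ 2 + 2 * n` symbols, and the marks alone make the input at least `n *
  -- (n + 1)` long.
  have hsize : stackSize (regs (encodePending (fun i j => !z (A.entries i j))
      (List.finRange A.n).reverse) [] [] [] [] (.replicate A.n .mid) []
      (.replicate (6 * A.n ^ 2) .tick)) ≤ 8 * N := by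
    have := le_length_encode (code := code) A
    simp [stackSize_regs, encodePending, rowBits, List.length_flatMap]
    nlinarith
  obtain ⟨h₂, h₃⟩ := hp₁ _ _ h₂
  obtain ⟨h₄, -⟩ := hp₂ _ _ (leads_drainAll none .scan S)
  refine ⟨decide (S .row = [] ∧ S .pending = []), by simpa using hS, ?_⟩
  have h₅ := h₁.seq ((runs_onRegs (h₂.mono (eval_mono p₁ hsize)) tm.initialState none (fun _ => [])
    [] [] []).seq ((runs_verdict S).seq (runs_onRegs (h₄.mono (eval_mono p₂ (h₃.trans hsize)))
      tm.initialState none (fun _ => []) [] [] [decide (S .row = [] ∧ S .pending = [])])))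
  have e₃ : regs [] [] [] [] [] [] [] [] = fun _ => [] := by
    funext k
    cases k <;> rfl
  rw [e₃] at h₅
  exact h₅.mono (by simp)

end SigningMachine

open SigningMachine Auction in
/-- InvertibleSigning is solvable in polynomial time if numerals for zero can be recognized in
polynomial time. -/
theorem InvertibleSigningInPolyTime.of_polyTimeDecidable {D Γ : Type} [Fintype Γ]
    {code : D → List Γ} {val : D → ℝ} (h : PolyTimeDecidable code fun d => val d = 0) : InvertibleSigningInPolyTime code val := by
  classical
  obtain ⟨h⟩ := h
  obtain ⟨p, hp⟩ := runs_machine (val := val) (z := fun d => decide (val d = 0))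
    (eq₀ := h.inputAlphabet) (eq₁ := h.outputAlphabet)
    (q := h.time) (fun d => by
      exact h.outputsFun d)
  have := h.tm.σFin
  have := h.tm.kFin
  refine PolyTimeDecidable.of_routine (machine h.inputAlphabet h.outputAlphabet) (idle h.tm Γ)
    (aux h.tm .inp) (aux h.tm .out) (Equiv.refl _) (Equiv.refl _) p fun A => ?_
  obtain ⟨b, hb, hr⟩ := hp A
  refine ⟨b, ?_, ?_⟩
  · refine hb.trans (Iff.trans ?_ (hasInvertibleSigning_iff A.symm).symm)
    simp [HasPerm]
  · have e₁ : (Function.update (fun _ => []) (aux h.tm .inp)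
          ((A.encode code).map (Equiv.refl _).symm) : ∀ k, List (SigningMachine.Alph h.tm Γ k)) =
        tapes (fun _ => []) (A.encode code) [] [] fun _ => [] := by
      funext k
      rcases k with _ | (_ | _ | _) | _ <;> simp
    have e₂ : (Function.update (fun _ => []) (aux h.tm .out) [(Equiv.refl _).symm b] :
          ∀ k, List (SigningMachine.Alph h.tm Γ k)) =
        tapes (fun _ => []) [] [] [b] fun _ => [] := by
      funext k
      rcases k with _ | (_ | _ | _) | _ <;> simp
    rw [e₁, e₂]
    exact hr

/-! ### Rational numbers in binary -/

namespace RatBinary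

open Routine Computability

/-- The alphabets of the input stack `false` and the output stack `true`. -/
abbrev Alph : Bool → Type
  | false => Γ'
  | true => Bool

/-- Read two symbols and remember whether the second is a separator. -/
def peekNumerator : Routine Alph (Option Γ' × Bool) :=
  op (.pop false (fun v _ => v) <| .pop false (fun _ o => (none, o == some .comma)) .halt)

/-- Empty the input stack. -/
def drain : Routine Alph (Option Γ' × Bool) :=
  loop (ι := Unit) (.pop false (fun v o => (o, v.2)) <| .branch (fun v => v.1.isSome)
    (.goto fun _ => ()) .halt) fun _ => skip

/-- Write the answer. -/
def verdict : Routine Alph (Option Γ' × Bool) :=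
  op (.push true (fun v => v.2) <| .load (fun _ => (none, false)) .halt)

theorem runs_drain (b : Bool) (l : List Γ') (o : Option Γ') :
    drain.Runs ((o, b), Function.update (fun _ => []) false l) ((none, b), fun _ => [])
      (2 * l.length + 1) := by
  induction l generalizing o with
  | nil => exact Runs.loop_halt (by simp)
  | cons a l ih =>
    have := Runs.loop_goto (i := ()) (t := 1)
      (c := ((o, b), Function.update (fun _ => []) false (a :: l)))
      (d := ((some a, b), Function.update (fun _ => []) false l)) (by simp) Runs.skip (ih _)
    refine this.mono ?_
    rw [List.length_cons]
    lia

theorem runs_zeroTest (a s : Γ') (l : List Γ') :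
    (peekNumerator.seq (drain.seq verdict)).Runs
      ((none, false), Function.update (fun _ => []) false (a :: s :: l))
      ((none, false), Function.update (fun _ => []) true [s == .comma]) (2 * l.length + 3) := by
  have h₁ : peekNumerator.Runs ((none, false), Function.update (fun _ => []) false (a :: s :: l))
      ((none, s == .comma), Function.update (fun _ => []) false l) 1 := Runs.op (by simp)
  have h₂ : verdict.Runs ((none, s == .comma), fun _ => [])
      ((none, false), Function.update (fun _ => []) true [s == .comma]) 1 := Runs.op (by simp)
  exact (h₁.seq ((runs_drain _ l none).seq h₂)).mono (by lia)

/-- The binary code of the natural number `0` is empty, so the separator follows the sign bit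
exactly when the numerator is zero. Two symbols thus decide the test. -/
theorem eq_cons_cons (q : ℚ) :
    ∃ a s l, ratBinary q = a :: s :: l ∧ ((s == .comma) = true ↔ q = 0) := by
  rcases h : encodeNat q.num.natAbs with _ | ⟨b, l⟩
  · refine ⟨_, _, _, by rw [ratBinary, h, List.map_nil, List.nil_append], ?_⟩
    have h₁ := decode_encodeNat q.num.natAbs
    rw [h] at h₁
    have h₂ : q.num.natAbs = 0 := h₁.symm
    simpa using h₂
  · refine ⟨_, _, _, by rw [ratBinary, h, List.map_cons, List.cons_append], ?_⟩
    have h₁ : q ≠ 0 := by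
      rintro rfl
      simp [encodeNat, encodeNum] at h
    simpa using h₁

theorem polyTimeDecidable : PolyTimeDecidable ratBinary fun q : ℚ => (q : ℝ) = 0 := by
  refine PolyTimeDecidable.of_routine (peekNumerator.seq (drain.seq verdict)) (none, false)
    false true (Equiv.refl _) (Equiv.refl _) (2 * .X + 3) fun q => ?_
  obtain ⟨a, s, l, h, hs⟩ := eq_cons_cons q
  refine ⟨s == .comma, hs.trans Rat.cast_eq_zero.symm, ?_⟩
  simpa [h] using (runs_zeroTest a s l).mono (t' := 2 * (l.length + 1 + 1) + 3) (by lia)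

end RatBinary

/-- InvertibleSigning is solvable in polynomial time: for rational matrices in binary, and, more
generally, for real matrices whose entries are written in any number system (over a finite
alphabet) in which it can be tested in polynomial time whether a number is zero. -/
theorem theorem3 :
    InvertibleSigningInPolyTime ratBinary (fun q : ℚ => (q : ℝ)) ∧
    ∀ (D Γ : Type) [Fintype Γ] (code : D → List Γ) (val : D → ℝ),
      PolyTimeDecidable code (fun d => val d = 0) →
      InvertibleSigningInPolyTime code val :=
  ⟨.of_polyTimeDecidable RatBinary.polyTimeDecidable, fun _ _ _ _ _ => .of_polyTimeDecidable⟩
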